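/- **Theorem 1.2 (Sparse $C_3$–$C_5$ removal lemma).** For every real $\varepsilon>0$ there exist a real $\delta>0$ and a natural number $n_0$ such that the following holds for every $n\ge n_0$. Let $G$ be a simple graph on $n$ vertices that contains at most $\delta n^{2}$ copies of the $4$-cycle $C_4$ and at most $\delta n^{5/2}$ copies of the $5$-cycle $C_5$. Then there is a set $E$ of at most $\varepsilon n^{3/2}$ edges of $G$ such that the graph obtained from $G$ by deleting the edges in $E$ contains neither a copy of $C_3$ nor a copy of $C_5$. Here a copy of $C_k$ in $G$ is a (not necessarily induced) subgraph of $G$ isomorphic to the cycle on $k$ vertices. -/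

import Mathlib

/-! Write r = √n. This is a removal lemma at edge density about 1/r, where neither regularity nor
counting comes for free; the scarcity of C₄ supplies both. Off the diagonal, the entries of the
square of the adjacency matrix A exceed 1 by little in total (`sum_pathExcess_le`). Deleting the
edges at vertices of large degree or large excess costs few edges and makes both bounds hold at
every vertex: degrees at most 2r, excess at most γr² (`exists_le_degree_pathExcess_le`).

Regularity: let E be the projection averaging over the parts of a partition. The energy ‖EAE‖² is at
most tr(EA²), hence at most n plus the number of parts times the excess (`blockEnergy_le`). It is
thus O(n) for partitions of bounded size, exactly what an energy increment with cut error κn^(3/2)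
requires. Iteration gives a partition P and a refinement Q of nearly equal energy
(`exists_strong_regular`). The cut error of Q may depend on the size of P, and must, since the
pentagon count depends on the size of the blocks of P.

Counting: in the trace of a product of five dense matrices, the factors are replaced one at a time
by sparse ones (`pentagon_counting`). A cut bound is useful only against weights with small entries.
When a weight is a product of two sparse matrices, it is truncated at 1, and the small excess pays
for that.

Removal: few edges lie in blocks of P that are small, sparse, or on which Q is often sparse
(`adjCount_bad_blocks_le`). Once these are deleted, a surviving triangle or pentagon gives a closed
walk of length five through good blocks, and counting there yields more than δr⁵ pentagons
(`le_copyCount_cycleGraph_five`). -/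

open Finset Matrix

/-! ### One-sided cut approximation tested against weights. -/

/-- On every rectangle, the total weight of `t` exceeds that of `g` by at most `K`. -/
def CutBelow {V : Type*} (K : ℝ) (t g : Matrix V V ℝ) : Prop :=
  ∀ A B : Finset V, ∑ x ∈ A, ∑ y ∈ B, (t x y - g x y) ≤ K

/-- The weights u only help where h is positive, so A can be the positivity set of h. -/
lemma exists_sum_mul_le_mul_sum {V : Type*} [Fintype V] (h u : V → ℝ) {U : ℝ}
    (hu : ∀ x, u x ∈ Set.Icc 0 U) :
    ∃ A : Finset V, ∑ x, u x * h x ≤ U * ∑ x ∈ A, h x := by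
  classical
  refine ⟨univ.filter fun x => 0 < h x, ?_⟩
  rw [Finset.mul_sum, Finset.sum_filter]
  refine Finset.sum_le_sum fun x _ => ?_
  split_ifs with hx
  · exact mul_le_mul_of_nonneg_right (hu x).2 hx.le
  · exact mul_nonpos_of_nonneg_of_nonpos (hu x).1 (not_lt.1 hx)

lemma CutBelow.sum_mul_mul_le {V : Type*} [Fintype V] {K : ℝ} {t g : Matrix V V ℝ}
    (hcut : CutBelow K t g) {u w : V → ℝ} {U W : ℝ} (hU : 0 ≤ U) (hW : 0 ≤ W)
    (hu : ∀ x, u x ∈ Set.Icc 0 U) (hw : ∀ x, w x ∈ Set.Icc 0 W) :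
    ∑ x, ∑ y, (t x y - g x y) * w y * u x ≤ K * U * W := by
  obtain ⟨A, hA⟩ := exists_sum_mul_le_mul_sum (fun x => ∑ y, (t x y - g x y) * w y) u hu
  obtain ⟨B, hB⟩ := exists_sum_mul_le_mul_sum (fun y => ∑ x ∈ A, (t x y - g x y)) w hw
  have e1 : ∑ x, ∑ y, (t x y - g x y) * w y * u x
      = ∑ x, u x * ∑ y, (t x y - g x y) * w y := by
    refine Finset.sum_congr rfl fun x _ => ?_
    rw [Finset.mul_sum]
    exact Finset.sum_congr rfl fun y _ => by ring
  have e2 : ∑ x ∈ A, ∑ y, (t x y - g x y) * w y = ∑ y, w y * ∑ x ∈ A, (t x y - g x y) := by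
    rw [Finset.sum_comm]
    refine Finset.sum_congr rfl fun y _ => ?_
    rw [Finset.mul_sum]
    exact Finset.sum_congr rfl fun y _ => by ring
  have e3 : ∑ y ∈ B, ∑ x ∈ A, (t x y - g x y) ≤ K := by
    rw [Finset.sum_comm]; exact hcut A B
  rw [e1]
  calc _ ≤ U * (W * K) := hA.trans (mul_le_mul_of_nonneg_left
          (e2.trans_le (hB.trans (mul_le_mul_of_nonneg_left e3 hW))) hU)
    _ = _ := by ring

/-- Fixing the third vertex k of the triangle leaves a sum over t - g with weights Y · k and Z k ·.
Each of the |V| choices of k costs K·U·W. -/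
lemma CutBelow.trace_mul_mul_le {V : Type*} [Fintype V] {K : ℝ} {t g Y Z : Matrix V V ℝ}
    (hcut : CutBelow K t g) {U W : ℝ} (hU : 0 ≤ U) (hW : 0 ≤ W)
    (hY : ∀ x y, Y x y ∈ Set.Icc 0 U) (hZ : ∀ x y, Z x y ∈ Set.Icc 0 W) :
    (t * (Y * Z)).trace ≤ (g * (Y * Z)).trace + Fintype.card V * (K * U * W) := by
  rw [← sub_le_iff_le_add', ← Matrix.trace_sub, ← Matrix.sub_mul]
  have e : ((t - g) * (Y * Z)).trace
      = ∑ k, ∑ x, ∑ y, (t x y - g x y) * Y y k * Z k x := by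
    simp only [Matrix.trace, Matrix.diag, Matrix.mul_apply, Matrix.sub_apply, Finset.mul_sum]
    rw [Finset.sum_comm' (t' := univ) (s' := fun _ => univ) (by simp)]
    rw [Finset.sum_comm]
    refine (Finset.sum_congr rfl fun x _ => Finset.sum_comm).trans ?_
    rw [Finset.sum_comm]
    exact Finset.sum_congr rfl fun _ _ => Finset.sum_congr rfl fun _ _ =>
      Finset.sum_congr rfl fun _ _ => by ring
  rw [e]
  refine (Finset.sum_le_sum fun k _ => ?_).trans_eq
    (b := ∑ k : V, K * U * W) (by simp)
  exact hcut.sum_mul_mul_le hW hU (fun x => hZ k x) (fun y => hY y k) |>.trans_eq (by ring)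

/-! ### Truncation, line sums and traces of nonnegative matrices. -/

namespace Matrix

/-- All row sums and all column sums are at most `D`. -/
structure LineSumLE {V : Type*} [Fintype V] (X : Matrix V V ℝ) (D : ℝ) : Prop where
  row : ∀ x, ∑ y, X x y ≤ D
  col : ∀ y, ∑ x, X x y ≤ D

variable {V : Type*}

/-- Entrywise truncation at `1`. -/
noncomputable def trunc (X : Matrix V V ℝ) : Matrix V V ℝ := fun x y => min (X x y) 1

lemma trunc_mem {X : Matrix V V ℝ} (hX : ∀ x y, 0 ≤ X x y) (x y : V) :
    X.trunc x y ∈ Set.Icc (0 : ℝ) 1 := ⟨le_min (hX x y) zero_le_one, min_le_right _ _⟩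

lemma trunc_le (X : Matrix V V ℝ) (x y : V) : X.trunc x y ≤ X x y := min_le_left _ _

variable [Fintype V]

lemma mul_apply_nonneg {X Y : Matrix V V ℝ} (hX : ∀ x y, 0 ≤ X x y) (hY : ∀ x y, 0 ≤ Y x y)
    (x y : V) : 0 ≤ (X * Y) x y := by
  rw [mul_apply]; exact Finset.sum_nonneg fun _ _ => mul_nonneg (hX _ _) (hY _ _)

lemma mul_apply_le_of_col {X Y : Matrix V V ℝ} {U D : ℝ} (hU : 0 ≤ U) (hX : ∀ x y, X x y ≤ U)
    (hY : ∀ x y, 0 ≤ Y x y) (hD : ∀ y, ∑ x, Y x y ≤ D) (x y : V) : (X * Y) x y ≤ U * D := by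
  rw [mul_apply]
  calc _ ≤ ∑ z, U * Y z y := Finset.sum_le_sum fun z _ =>
        mul_le_mul_of_nonneg_right (hX _ _) (hY _ _)
    _ = U * ∑ z, Y z y := by rw [Finset.mul_sum]
    _ ≤ U * D := mul_le_mul_of_nonneg_left (hD y) hU

lemma mul_apply_le_of_row {X Y : Matrix V V ℝ} {U D : ℝ} (hU : 0 ≤ U) (hY : ∀ x y, Y x y ≤ U)
    (hX : ∀ x y, 0 ≤ X x y) (hD : ∀ x, ∑ y, X x y ≤ D) (x y : V) : (X * Y) x y ≤ D * U := by
  rw [mul_apply]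
  calc _ ≤ ∑ z, X x z * U := Finset.sum_le_sum fun z _ =>
        mul_le_mul_of_nonneg_left (hY _ _) (hX _ _)
    _ = (∑ z, X x z) * U := by rw [Finset.sum_mul]
    _ ≤ D * U := mul_le_mul_of_nonneg_right (hD x) hU

lemma sum_row_mul_le {X Y : Matrix V V ℝ} {D E : ℝ} (hE : 0 ≤ E) (hX : ∀ x y, 0 ≤ X x y)
    (hXD : ∀ x, ∑ y, X x y ≤ D) (hYE : ∀ x, ∑ y, Y x y ≤ E) (x : V) :
    ∑ y, (X * Y) x y ≤ D * E := by
  simp only [mul_apply]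
  rw [Finset.sum_comm]
  calc _ = ∑ z, X x z * ∑ y, Y z y := Finset.sum_congr rfl fun _ _ => by rw [Finset.mul_sum]
    _ ≤ ∑ z, X x z * E := Finset.sum_le_sum fun z _ => mul_le_mul_of_nonneg_left (hYE z) (hX _ _)
    _ = (∑ z, X x z) * E := by rw [Finset.sum_mul]
    _ ≤ D * E := mul_le_mul_of_nonneg_right (hXD x) hE

lemma LineSumLE.mul {X Y : Matrix V V ℝ} {D E : ℝ} (hD : 0 ≤ D) (hE : 0 ≤ E)
    (hX : ∀ x y, 0 ≤ X x y) (hY : ∀ x y, 0 ≤ Y x y)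
    (hXD : X.LineSumLE D) (hYE : Y.LineSumLE E) : (X * Y).LineSumLE (D * E) := by
  refine ⟨sum_row_mul_le hE hX hXD.row hYE.row, fun y => ?_⟩
  have := sum_row_mul_le (X := Yᵀ) (Y := Xᵀ) hD (fun x y => hY y x) hYE.col hXD.col y
  rw [← transpose_mul] at this
  simpa [mul_comm] using this

lemma sum_sum_mul_le_of_row {X Y : Matrix V V ℝ} {D : ℝ} (hX : ∀ x y, 0 ≤ X x y)
    (hY : ∀ x, ∑ y, Y x y ≤ D) : ∑ x, ∑ y, (X * Y) x y ≤ (∑ x, ∑ y, X x y) * D := by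
  rw [Finset.sum_mul]
  refine Finset.sum_le_sum fun x _ => ?_
  simp only [mul_apply]
  rw [Finset.sum_comm, Finset.sum_mul]
  refine Finset.sum_le_sum fun z _ => ?_
  rw [← Finset.mul_sum]
  exact mul_le_mul_of_nonneg_left (hY z) (hX _ _)

lemma sum_sum_mul_le_of_col {X Y : Matrix V V ℝ} {D : ℝ} (hY : ∀ x y, 0 ≤ Y x y)
    (hX : ∀ y, ∑ x, X x y ≤ D) : ∑ x, ∑ y, (X * Y) x y ≤ (∑ x, ∑ y, Y x y) * D := by
  have := sum_sum_mul_le_of_row (X := Yᵀ) (Y := Xᵀ) (D := D) (fun x y => hY y x) hX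
  rw [← transpose_mul] at this
  exact Finset.sum_comm.trans_le (this.trans_eq (congrArg (· * D) Finset.sum_comm))

lemma trace_mul_le {X Y : Matrix V V ℝ} {U : ℝ} (hX : ∀ x y, X x y ≤ U)
    (hY : ∀ x y, 0 ≤ Y x y) : (X * Y).trace ≤ U * ∑ x, ∑ y, Y x y := by
  refine le_trans ?_ (congrArg (U * ·) Finset.sum_comm).le
  rw [trace, Finset.mul_sum]
  refine Finset.sum_le_sum fun x _ => ?_
  rw [diag_apply, mul_apply, Finset.mul_sum]
  exact Finset.sum_le_sum fun y _ => mul_le_mul_of_nonneg_right (hX _ _) (hY _ _)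

lemma trace_mul_le_trace_mul {X Y Z : Matrix V V ℝ} (hX : ∀ x y, 0 ≤ X x y)
    (hYZ : ∀ x y, Y x y ≤ Z x y) : (X * Y).trace ≤ (X * Z).trace := by
  simp only [trace, diag_apply, mul_apply]
  exact Finset.sum_le_sum fun x _ => Finset.sum_le_sum fun y _ =>
    mul_le_mul_of_nonneg_left (hYZ _ _) (hX _ _)

end Matrix

/-! ### The counting lemma for closed walks of length five. -/

/-- Lower bound for the number of closed walks of length five through five sparse bipartite graphs
`g₁, …, g₅` that dominate `β • s₁, …, β • s₅` on rectangles and have few excess paths of length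
two. -/
theorem pentagon_counting {V : Type*} [Fintype V] {n K D Γ β : ℝ} (hn : n = Fintype.card V)
    (hD : 0 ≤ D) (hβ : 0 ≤ β)
    {g₁ g₂ g₃ g₄ g₅ s₁ s₂ s₃ s₄ s₅ : Matrix V V ℝ}
    (hg₁ : ∀ x y, 0 ≤ g₁ x y) (hg₂ : ∀ x y, 0 ≤ g₂ x y) (hg₃ : ∀ x y, 0 ≤ g₃ x y)
    (hg₄ : ∀ x y, 0 ≤ g₄ x y) (hg₅ : ∀ x y, 0 ≤ g₅ x y)
    (hs₁ : ∀ x y, s₁ x y ∈ Set.Icc (0 : ℝ) 1) (hs₂ : ∀ x y, s₂ x y ∈ Set.Icc (0 : ℝ) 1)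
    (hs₃ : ∀ x y, s₃ x y ∈ Set.Icc (0 : ℝ) 1)
    (hs₅ : ∀ x y, s₅ x y ∈ Set.Icc (0 : ℝ) 1)
    (hd₁ : g₁.LineSumLE D) (hd₂ : g₂.LineSumLE D) (hd₄ : g₄.LineSumLE D) (hd₅ : g₅.LineSumLE D)
    (hc₁ : CutBelow K (β • s₁) g₁) (hc₂ : CutBelow K (β • s₂) g₂) (hc₃ : CutBelow K (β • s₃) g₃)
    (hc₄ : CutBelow K (β • s₄) g₄) (hc₅ : CutBelow K (β • s₅) g₅)
    (hE₁ : ∑ x, ∑ y, ((g₁ * g₂) x y - (g₁ * g₂).trunc x y) ≤ n * Γ)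
    (hE₂ : ∑ x, ∑ y, ((g₄ * g₅) x y - (g₄ * g₅).trunc x y) ≤ n * Γ) :
    β ^ 5 * (s₁ * s₂ * s₃ * s₄ * s₅).trace
      - (β ^ 4 * n ^ 3 * K + β ^ 3 * n ^ 2 * D * K + β ^ 2 * n * D ^ 2 * K + β * n * D * K + n * K
        + β ^ 2 * n ^ 2 * D * Γ + 2 * β * n * D ^ 2 * Γ)
      ≤ (g₁ * g₂ * g₃ * g₄ * g₅).trace := by
  have hn0 : 0 ≤ n := hn ▸ Nat.cast_nonneg _
  have hH := mul_apply_nonneg hg₁ hg₂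
  have hH' := mul_apply_nonneg hg₄ hg₅
  have hHD := LineSumLE.mul hD hD hg₁ hg₂ hd₁ hd₂
  have hHD' := LineSumLE.mul hD hD hg₄ hg₅ hd₄ hd₅
  have one_row : ∀ {s : Matrix V V ℝ}, (∀ x y, s x y ∈ Set.Icc (0 : ℝ) 1) →
      ∀ x, ∑ y, s x y ≤ n := fun {s} hs x =>
    (Finset.sum_le_sum fun y _ => (hs x y).2).trans_eq (by simp [hn])
  have s_nonneg : ∀ {s : Matrix V V ℝ}, (∀ x y, s x y ∈ Set.Icc (0 : ℝ) 1) →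
      ∀ x y, 0 ≤ s x y := fun {s} hs x y => (hs x y).1
  have s_le : ∀ {s : Matrix V V ℝ}, (∀ x y, s x y ∈ Set.Icc (0 : ℝ) 1) →
      ∀ x y, s x y ≤ 1 := fun {s} hs x y => (hs x y).2
  have hT := trunc_mem hH
  have hT' := trunc_mem hH'
  obtain ⟨H, hHdef⟩ : ∃ H, H = g₁ * g₂ := ⟨_, rfl⟩
  obtain ⟨H', hHdef'⟩ : ∃ H', H' = g₄ * g₅ := ⟨_, rfl⟩
  rw [← hHdef] at hH hHD hT hE₁
  rw [← hHdef'] at hH' hHD' hT' hE₂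
  have hEn : ∀ x y, 0 ≤ (H - H.trunc) x y := fun x y => sub_nonneg.2 (trunc_le _ _ _)
  have hEn' : ∀ x y, 0 ≤ (H' - H'.trunc) x y := fun x y => sub_nonneg.2 (trunc_le _ _ _)
  have hE₁ : ∑ x, ∑ y, (H - H.trunc) x y ≤ n * Γ := hE₁
  have hE₂ : ∑ x, ∑ y, (H' - H'.trunc) x y ≤ n * Γ := hE₂
  -- The factors become sparse in the order s₄, s₅, s₂, s₁, s₃. For the first three, line sums bound
  -- the weights well enough, by n², nD and D². For the last two, the weights involve H and H',
  -- which are truncated to have entries at most 1.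
  have step5 : β * (s₄ * (s₅ * (s₁ * s₂ * s₃))).trace
      ≤ (g₄ * (s₅ * (s₁ * s₂ * s₃))).trace + n * (K * 1 * (n * n)) := by
    have := hc₄.trace_mul_mul_le (Y := s₅) (Z := s₁ * s₂ * s₃) (U := 1) (W := n * n)
      zero_le_one (by positivity) hs₅ (fun x y =>
        ⟨mul_apply_nonneg (mul_apply_nonneg (s_nonneg hs₁) (s_nonneg hs₂)) (s_nonneg hs₃) x y, by
          simpa using mul_apply_le_of_row zero_le_one (s_le hs₃)
            (mul_apply_nonneg (s_nonneg hs₁) (s_nonneg hs₂))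
            (sum_row_mul_le hn0 (s_nonneg hs₁) (one_row hs₁) (one_row hs₂)) x y⟩)
    rwa [smul_mul, trace_smul, smul_eq_mul, ← hn] at this
  have step4 : β * (s₅ * ((s₁ * s₂) * (s₃ * g₄))).trace
      ≤ (g₅ * ((s₁ * s₂) * (s₃ * g₄))).trace + n * (K * n * D) := by
    have := hc₅.trace_mul_mul_le (Y := s₁ * s₂) (Z := s₃ * g₄) (U := n) (W := D) hn0 hD
      (fun x y => ⟨mul_apply_nonneg (s_nonneg hs₁) (s_nonneg hs₂) x y, by
        simpa using mul_apply_le_of_row zero_le_one (s_le hs₂) (s_nonneg hs₁) (one_row hs₁) x y⟩)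
      (fun x y => ⟨mul_apply_nonneg (s_nonneg hs₃) hg₄ x y, by
        simpa using mul_apply_le_of_col zero_le_one (s_le hs₃) hg₄ hd₄.col x y⟩)
    rwa [smul_mul, trace_smul, smul_eq_mul, ← hn] at this
  have step3 : β * (s₂ * (s₃ * (H' * s₁))).trace
      ≤ (g₂ * (s₃ * (H' * s₁))).trace + n * (K * 1 * (D * D)) := by
    have := hc₂.trace_mul_mul_le (Y := s₃) (Z := H' * s₁) (U := 1) (W := D * D) zero_le_one
      (by positivity) hs₃
      (fun x y => ⟨mul_apply_nonneg hH' (s_nonneg hs₁) x y, by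
        simpa using mul_apply_le_of_row zero_le_one (s_le hs₁) hH' hHD'.row x y⟩)
    rwa [smul_mul, trace_smul, smul_eq_mul, ← hn] at this
  have hgs : ∀ x y, (g₂ * s₃) x y ∈ Set.Icc 0 D := fun x y =>
    ⟨mul_apply_nonneg hg₂ (s_nonneg hs₃) x y, by
      simpa using mul_apply_le_of_row zero_le_one (s_le hs₃) hg₂ hd₂.row x y⟩
  have step2a : β * (s₁ * ((g₂ * s₃) * H'.trunc)).trace
      ≤ (g₁ * ((g₂ * s₃) * H'.trunc)).trace + n * (K * D * 1) := by
    have := hc₁.trace_mul_mul_le (Y := g₂ * s₃) (Z := H'.trunc) (U := D) (W := 1) hD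
      zero_le_one hgs hT'
    rwa [smul_mul, trace_smul, smul_eq_mul, ← hn] at this
  have step2b : (g₁ * ((g₂ * s₃) * H'.trunc)).trace ≤ (g₁ * ((g₂ * s₃) * H')).trace := by
    rw [← mul_assoc g₁ _ H'.trunc, ← mul_assoc g₁ _ H']
    exact trace_mul_le_trace_mul (mul_apply_nonneg hg₁ fun x y => (hgs x y).1) (trunc_le _)
  -- Truncation loses mass only in the trace where s₁ is still dense, so the excess meets a factor
  -- with entries at most nD. On the sparse side, truncation only decreases the trace.
  have step2c : (s₁ * ((g₂ * s₃) * H')).trace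
      ≤ (s₁ * ((g₂ * s₃) * H'.trunc)).trace + (n * D) * (n * Γ) := by
    have h := trace_mul_le (X := s₁ * (g₂ * s₃)) (Y := H' - H'.trunc) (U := n * D)
      (mul_apply_le_of_row hD (fun x y => (hgs x y).2) (s_nonneg hs₁) (one_row hs₁)) hEn'
    rw [mul_sub, trace_sub, sub_le_iff_le_add'] at h
    rw [← mul_assoc s₁ _ H'.trunc, ← mul_assoc s₁ _ H']
    exact h.trans (add_le_add_right (mul_le_mul_of_nonneg_left hE₂ (by positivity)) _)
  have step1a : β * (s₃ * (H'.trunc * H.trunc)).trace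
      ≤ (g₃ * (H'.trunc * H.trunc)).trace + n * (K * 1 * 1) := by
    have := hc₃.trace_mul_mul_le zero_le_one zero_le_one hT' hT
    rwa [smul_mul, trace_smul, smul_eq_mul, ← hn] at this
  have step1b : (g₃ * (H'.trunc * H.trunc)).trace ≤ (g₃ * (H' * H)).trace := by
    refine trace_mul_le_trace_mul hg₃ fun x y => ?_
    rw [mul_apply, mul_apply]
    exact Finset.sum_le_sum fun z _ => mul_le_mul (trunc_le _ _ _) (trunc_le _ _ _) (hT _ _).1
      (hH' _ _)
  have step1c : (s₃ * (H' * H)).trace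
      ≤ (s₃ * (H'.trunc * H.trunc)).trace + 2 * (n * Γ * (D * D)) := by
    have h1 := trace_mul_le (X := s₃) (Y := (H' - H'.trunc) * H) (U := 1) (s_le hs₃)
      (mul_apply_nonneg hEn' hH)
    have h2 := trace_mul_le (X := s₃) (Y := H'.trunc * (H - H.trunc)) (U := 1) (s_le hs₃)
      (mul_apply_nonneg (fun x y => (hT' x y).1) hEn)
    have h3 := sum_sum_mul_le_of_row hEn' hHD.row
    have h4 := sum_sum_mul_le_of_col (X := H'.trunc) hEn (D := D * D)
      (fun y => (Finset.sum_le_sum fun x _ => trunc_le _ _ _).trans (hHD'.col y))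
    have h5 := mul_le_mul_of_nonneg_right hE₂ (mul_nonneg hD hD)
    have h6 := mul_le_mul_of_nonneg_right hE₁ (mul_nonneg hD hD)
    have e : s₃ * (H' * H) = s₃ * (H'.trunc * H.trunc) + s₃ * ((H' - H'.trunc) * H)
        + s₃ * (H'.trunc * (H - H.trunc)) := by
      rw [← mul_add, ← mul_add]; congr 1; noncomm_ring
    rw [e, trace_add, trace_add]
    linarith
  have cyc : ∀ X Y : Matrix V V ℝ, (X * Y).trace = (Y * X).trace := trace_mul_comm
  have c0 : (g₁ * g₂ * g₃ * g₄ * g₅).trace = (g₃ * (H' * H)).trace := by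
    have := cyc (g₁ * g₂) (g₃ * (g₄ * g₅))
    simpa only [hHdef, hHdef', mul_assoc] using this
  have c1 : (s₃ * (H' * H)).trace = (g₁ * ((g₂ * s₃) * H')).trace := by
    have := cyc (s₃ * H') (g₁ * g₂)
    simpa only [hHdef, mul_assoc] using this
  have c2 : (s₁ * ((g₂ * s₃) * H')).trace = (g₂ * (s₃ * (H' * s₁))).trace := by
    have := cyc s₁ (g₂ * s₃ * H')
    simpa only [mul_assoc] using this
  have c3 : (s₂ * (s₃ * (H' * s₁))).trace = (g₅ * ((s₁ * s₂) * (s₃ * g₄))).trace := by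
    have := cyc (s₂ * s₃ * g₄) (g₅ * s₁)
    simpa only [hHdef', mul_assoc] using this.trans
      ((congrArg trace (mul_assoc g₅ s₁ _)).trans (by simp only [mul_assoc]))
  have c4 : (s₅ * ((s₁ * s₂) * (s₃ * g₄))).trace = (g₄ * (s₅ * (s₁ * s₂ * s₃))).trace := by
    have := cyc (s₅ * s₁ * s₂ * s₃) g₄
    simpa only [mul_assoc] using this
  have c5 : (s₄ * (s₅ * (s₁ * s₂ * s₃))).trace = (s₁ * s₂ * s₃ * s₄ * s₅).trace := by
    have := cyc (s₄ * s₅) (s₁ * s₂ * s₃)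
    simpa only [mul_assoc] using this
  rw [c0]
  rw [c5] at step5
  rw [c4] at step4
  rw [c3] at step3
  rw [c2] at step2c
  rw [c1] at step1c
  have i5 := mul_le_mul_of_nonneg_left step5 (pow_nonneg hβ 4)
  have i4 := mul_le_mul_of_nonneg_left step4 (pow_nonneg hβ 3)
  have i3 := mul_le_mul_of_nonneg_left step3 (pow_nonneg hβ 2)
  have i2 := mul_le_mul_of_nonneg_left (step2a.trans (add_le_add_left step2b _)) hβ
  have i2' := mul_le_mul_of_nonneg_left step2c (pow_nonneg hβ 2)
  have i1 := step1a.trans (add_le_add_left step1b _)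
  have i1' := mul_le_mul_of_nonneg_left step1c hβ
  linarith

/-! ### Block averages, energy and regularity; partitions are the fibres of maps to ℕ. -/

section Averaging

variable {V : Type*}

/-- `φ x y` depends only on the fibres of `x` and `y`. -/
def BlockConst (q : V → ℕ) (φ : Matrix V V ℝ) : Prop :=
  ∀ x x' y y', q x = q x' → q y = q y' → φ x y = φ x' y'

lemma BlockConst.transpose {q : V → ℕ} {φ : Matrix V V ℝ} (h : BlockConst q φ) :
    BlockConst q φᵀ := fun x x' y y' hx hy => h y y' x x' hy hx

/-- Every fibre of `q'` is contained in a fibre of `q`. -/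
def FibreRefines (q' q : V → ℕ) : Prop := ∀ x y, q' x = q' y → q x = q y

lemma FibreRefines.trans {q q' q'' : V → ℕ} (h : FibreRefines q'' q') (h' : FibreRefines q' q) :
    FibreRefines q'' q := fun x y hxy => h' x y (h x y hxy)

lemma BlockConst.of_refines {q q' : V → ℕ} {φ : Matrix V V ℝ} (h : BlockConst q φ)
    (hr : FibreRefines q' q) : BlockConst q' φ :=
  fun x x' y y' hx hy => h x x' y y' (hr _ _ hx) (hr _ _ hy)

/-- The common refinement of `q` with the sets `A` and `B`. -/
noncomputable def splitBy (q : V → ℕ) (A B : Finset V) : V → ℕ := by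
  classical
  exact fun x => Nat.pair (q x) (Nat.pair (if x ∈ A then 1 else 0) (if x ∈ B then 1 else 0))

lemma splitBy_eq {q : V → ℕ} {A B : Finset V} {x y : V} (h : splitBy q A B x = splitBy q A B y) :
    q x = q y ∧ (x ∈ A ↔ y ∈ A) ∧ (x ∈ B ↔ y ∈ B) := by
  simp only [splitBy, Nat.pair_eq_pair] at h
  obtain ⟨h1, h2, h3⟩ := h
  refine ⟨h1, ?_, ?_⟩
  · by_cases hx : x ∈ A <;> by_cases hy : y ∈ A <;> simp_all
  · by_cases hx : x ∈ B <;> by_cases hy : y ∈ B <;> simp_all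

variable [Fintype V]

/-- The size of the fibre of `q` through `x`. -/
def fibreCard (q : V → ℕ) (x : V) : ℕ := #{y | q y = q x}

lemma fibreCard_pos (q : V → ℕ) (x : V) : 0 < fibreCard q x :=
  Finset.card_pos.2 ⟨x, by simp⟩

lemma fibreCard_congr {q : V → ℕ} {x y : V} (h : q x = q y) : fibreCard q x = fibreCard q y := by
  simp [fibreCard, h]

/-- The matrix of the operator averaging over the fibres of `q`. -/
noncomputable def avgMatrix (q : V → ℕ) : Matrix V V ℝ :=
  fun x y => if q y = q x then (fibreCard q x : ℝ)⁻¹ else 0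

lemma avgMatrix_blockConst (q : V → ℕ) : BlockConst q (avgMatrix q) := by
  intro x x' y y' hx hy
  simp [avgMatrix, hx, hy, fibreCard_congr hx]

lemma avgMatrix_transpose (q : V → ℕ) : (avgMatrix q)ᵀ = avgMatrix q := by
  ext x y
  simp only [transpose_apply, avgMatrix]
  by_cases h : q x = q y
  · simp [h, fibreCard_congr h]
  · simp [h, Ne.symm h]

lemma avgMatrix_nonneg (q : V → ℕ) (x y : V) : 0 ≤ avgMatrix q x y := by
  unfold avgMatrix; split_ifs <;> positivity

lemma sum_avgMatrix (q : V → ℕ) (x : V) : ∑ y, avgMatrix q x y = 1 := by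
  have : (fibreCard q x : ℝ) ≠ 0 := by exact_mod_cast (fibreCard_pos q x).ne'
  simp only [avgMatrix, ← Finset.sum_filter, Finset.sum_const, nsmul_eq_mul]
  exact mul_inv_cancel₀ this

lemma BlockConst.avg_mul {q : V → ℕ} {φ : Matrix V V ℝ} (h : BlockConst q φ) :
    avgMatrix q * φ = φ := by
  ext x y
  rw [mul_apply]
  have : ∀ z, avgMatrix q x z * φ z y = avgMatrix q x z * φ x y := fun z => by
    by_cases hz : q z = q x
    · rw [h z x y y hz rfl]
    · simp [avgMatrix, hz]
  rw [Finset.sum_congr rfl fun z _ => this z, ← Finset.sum_mul, sum_avgMatrix, one_mul]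

lemma BlockConst.mul_avg {q : V → ℕ} {φ : Matrix V V ℝ} (h : BlockConst q φ) :
    φ * avgMatrix q = φ := by
  have := congrArg Matrix.transpose h.transpose.avg_mul
  rwa [transpose_mul, avgMatrix_transpose, transpose_transpose] at this

/-- The average of `G` over the blocks given by pairs of fibres of `q`. -/
noncomputable def blockAvg (q : V → ℕ) (G : Matrix V V ℝ) : Matrix V V ℝ :=
  avgMatrix q * (G * avgMatrix q)

lemma blockAvg_transpose (q : V → ℕ) {G : Matrix V V ℝ} (hG : Gᵀ = G) :
    (blockAvg q G)ᵀ = blockAvg q G := by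
  simp only [blockAvg, transpose_mul, avgMatrix_transpose, hG, mul_assoc]

lemma blockAvg_nonneg (q : V → ℕ) {G : Matrix V V ℝ} (hG : ∀ x y, 0 ≤ G x y) (x y : V) :
    0 ≤ blockAvg q G x y :=
  mul_apply_nonneg (avgMatrix_nonneg q) (mul_apply_nonneg hG (avgMatrix_nonneg q)) x y

lemma blockAvg_blockConst (q : V → ℕ) (G : Matrix V V ℝ) : BlockConst q (blockAvg q G) := by
  intro x x' y y' hx hy
  simp only [blockAvg, mul_apply]
  refine Finset.sum_congr rfl fun z _ => ?_
  rw [avgMatrix_blockConst q x x' z z hx rfl]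
  congr 1
  exact Finset.sum_congr rfl fun w _ => by rw [avgMatrix_blockConst q w w y y' rfl hy]

/-- Averaging is a self-adjoint projection that fixes block-constant matrices. -/
lemma trace_blockAvg_mul {q : V → ℕ} {G φ : Matrix V V ℝ} (h : BlockConst q φ) :
    (blockAvg q G * φ).trace = (G * φ).trace := by
  rw [blockAvg, mul_assoc, trace_mul_comm, mul_assoc G, mul_assoc G, h.avg_mul, h.mul_avg]

lemma sum_sum_blockAvg_mul {q : V → ℕ} {G φ : Matrix V V ℝ} (h : BlockConst q φ) :
    ∑ x, ∑ y, blockAvg q G x y * φ x y = ∑ x, ∑ y, G x y * φ x y := by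
  simpa [trace, diag_apply, mul_apply] using trace_blockAvg_mul (G := G) h.transpose

/-- The mean square of the block densities. -/
noncomputable def blockEnergy (q : V → ℕ) (G : Matrix V V ℝ) : ℝ :=
  ∑ x, ∑ y, blockAvg q G x y ^ 2

lemma blockEnergy_nonneg (q : V → ℕ) (G : Matrix V V ℝ) : 0 ≤ blockEnergy q G :=
  Finset.sum_nonneg fun _ _ => Finset.sum_nonneg fun _ _ => sq_nonneg _

/-- Pythagoras: the coarse average is the orthogonal projection of the finer one. -/
lemma sum_sq_sub_blockAvg {q q' : V → ℕ} (hr : FibreRefines q' q) (G : Matrix V V ℝ) :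
    ∑ x, ∑ y, (blockAvg q' G x y - blockAvg q G x y) ^ 2
      = blockEnergy q' G - blockEnergy q G := by
  have hc := blockAvg_blockConst q G
  have h1 : ∑ x, ∑ y, blockAvg q' G x y * blockAvg q G x y = ∑ x, ∑ y, blockAvg q G x y ^ 2 := by
    rw [sum_sum_blockAvg_mul (hc.of_refines hr), ← sum_sum_blockAvg_mul hc]
    simp only [sq]
  have h2 : ∀ x y, (blockAvg q' G x y - blockAvg q G x y) ^ 2
      = blockAvg q' G x y ^ 2 - 2 * (blockAvg q' G x y * blockAvg q G x y)
        + blockAvg q G x y ^ 2 := fun x y => by ring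
  simp only [h2, Finset.sum_add_distrib, Finset.sum_sub_distrib, ← Finset.mul_sum, h1, blockEnergy]
  ring

lemma sum_inv_fibreCard (q : V → ℕ) :
    ∑ x, (fibreCard q x : ℝ)⁻¹ = #(univ.image q) := by
  rw [← Finset.sum_fiberwise_of_maps_to (g := q) (t := univ.image q)
    fun x _ => mem_image_of_mem q (mem_univ x), Finset.card_eq_sum_ones, Nat.cast_sum]
  refine Finset.sum_congr rfl fun i hi => ?_
  obtain ⟨x, -, rfl⟩ := mem_image.1 hi
  have : (fibreCard q x : ℝ) ≠ 0 := by exact_mod_cast (fibreCard_pos q x).ne'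
  rw [Finset.sum_congr rfl (g := fun _ => (fibreCard q x : ℝ)⁻¹)
    fun y hy => by rw [fibreCard_congr (mem_filter.1 hy).2], Finset.sum_const, nsmul_eq_mul]
  rw [Nat.cast_one]
  exact mul_inv_cancel₀ this

/-- With E the averaging projection, ‖EGE‖² ≤ ‖GE‖² = tr(EG²). This is an average of codegrees
within fibres, which the excess bound controls; in the sparse setting it replaces the trivial bound
on energy. -/
lemma blockEnergy_le (q : V → ℕ) {G : Matrix V V ℝ} (hG : Gᵀ = G) {Γ : ℝ}
    (hΓ : ∀ x, ∑ y, ((G * G) x y - (G * G).trunc x y) ≤ Γ)  :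
    blockEnergy q G ≤ Fintype.card V + #(univ.image q) * Γ := by
  have hid : avgMatrix q * avgMatrix q = avgMatrix q := (avgMatrix_blockConst q).avg_mul
  have sq_tr : ∀ X : Matrix V V ℝ, ∑ x, ∑ y, X x y ^ 2 = (X * Xᵀ).trace := fun X => by
    simp [trace, diag_apply, mul_apply, sq]
  have h1 : blockEnergy q G ≤ (avgMatrix q * (G * G)).trace := by
    have hpos : 0 ≤ ∑ x, ∑ y, (G * avgMatrix q - blockAvg q G) x y ^ 2 :=
      Finset.sum_nonneg fun _ _ => Finset.sum_nonneg fun _ _ => sq_nonneg _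
    have e : (G * avgMatrix q - blockAvg q G) * (G * avgMatrix q - blockAvg q G)ᵀ
        = G * avgMatrix q * G - G * avgMatrix q * (G * avgMatrix q)
          - blockAvg q G * G + blockAvg q G * blockAvg q G := by
      rw [transpose_sub, blockAvg_transpose q hG, transpose_mul, avgMatrix_transpose, hG,
        sub_mul, mul_sub, mul_sub]
      have a1 : G * avgMatrix q * (avgMatrix q * G) = G * avgMatrix q * G := by
        rw [mul_assoc, ← mul_assoc _ _ G, hid, mul_assoc]
      have a2 : G * avgMatrix q * blockAvg q G = G * avgMatrix q * (G * avgMatrix q) := by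
        rw [blockAvg, mul_assoc, ← mul_assoc (avgMatrix q) (avgMatrix q), hid, mul_assoc]
      have a3 : blockAvg q G * (avgMatrix q * G) = blockAvg q G * G := by
        rw [← mul_assoc, (blockAvg_blockConst q G).mul_avg]
      rw [a1, a2, a3]
      abel
    have b0 : (G * avgMatrix q * G).trace = (avgMatrix q * (G * G)).trace := by
      rw [mul_assoc, trace_mul_comm, mul_assoc]
    have b1 : (G * avgMatrix q * (G * avgMatrix q)).trace
        = (blockAvg q G * blockAvg q G).trace := by
      rw [trace_blockAvg_mul (blockAvg_blockConst q G), blockAvg, mul_assoc]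
    have b2 : (blockAvg q G * G).trace = (blockAvg q G * blockAvg q G).trace := by
      rw [trace_blockAvg_mul (blockAvg_blockConst q G), trace_mul_comm]
    rw [sq_tr, e, trace_add, trace_sub, trace_sub, b0, b1, b2] at hpos
    rw [blockEnergy, sq_tr, blockAvg_transpose q hG]
    linarith
  refine h1.trans ?_
  have hs : ∀ x y, (G * G) x y = (G * G) y x := fun x y => by
    have := congrFun (congrFun (transpose_mul G G) y) x
    rwa [hG] at this
  -- Split G² into its truncation, whose average over a fibre is at most 1, and its excess, whose
  -- row sum Γ enters with weight 1/`fibreCard`. Each fibre then contributes Γ in total.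
  have h2 : (avgMatrix q * (G * G)).trace ≤ ∑ x, (1 + (fibreCard q x : ℝ)⁻¹ * Γ) := by
    rw [trace]
    refine Finset.sum_le_sum fun x _ => ?_
    rw [diag_apply, mul_apply, ← sum_avgMatrix q x]
    have h3 := mul_le_mul_of_nonneg_left (hΓ x) (inv_nonneg.2 (Nat.cast_nonneg (fibreCard q x)))
    refine le_trans ?_ (add_le_add_right h3 _)
    rw [Finset.mul_sum, ← Finset.sum_add_distrib]
    refine Finset.sum_le_sum fun y _ => ?_
    rw [hs y x]
    have t1 := trunc_le (G * G) x y
    have t2 : (G * G).trunc x y ≤ 1 := min_le_right _ _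
    have t3 : (0 : ℝ) ≤ (fibreCard q x : ℝ)⁻¹ := inv_nonneg.2 (Nat.cast_nonneg _)
    unfold avgMatrix
    split_ifs
    · nlinarith
    · nlinarith
  refine h2.trans_eq ?_
  rw [Finset.sum_add_distrib, ← Finset.sum_mul, sum_inv_fibreCard]
  simp

lemma card_image_splitBy_le (q : V → ℕ) (A B : Finset V) :
    #(univ.image (splitBy q A B)) ≤ #(univ.image q) * 4 := by
  classical
  have : univ.image (splitBy q A B) ⊆ (univ.image q ×ˢ (range 2 ×ˢ range 2)).image
      fun t => Nat.pair t.1 (Nat.pair t.2.1 t.2.2) := by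
    intro i hi
    obtain ⟨x, -, rfl⟩ := mem_image.1 hi
    refine mem_image.2 ⟨(q x, if x ∈ A then 1 else 0, if x ∈ B then 1 else 0), ?_, ?_⟩
    · simp only [mem_product, mem_image, mem_univ, true_and, exists_apply_eq_apply, mem_range]
      constructor <;> split_ifs <;> norm_num
    · simp [splitBy]
  refine (card_le_card this).trans (card_image_le.trans ?_)
  simp [card_product]

/-- The indicator of A × B is constant on the new blocks, so G may be replaced by its finer average;
Cauchy–Schwarz then turns the discrepancy into an energy increment. -/
lemma blockEnergy_splitBy {q : V → ℕ} {G : Matrix V V ℝ} {K : ℝ} (hK : 0 ≤ K) {A B : Finset V}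
    (hAB : K < ∑ x ∈ A, ∑ y ∈ B, (blockAvg q G x y - G x y)) :
    K ^ 2 ≤ (Fintype.card V : ℝ) ^ 2 * (blockEnergy (splitBy q A B) G - blockEnergy q G) := by
  classical
  set q' := splitBy q A B
  have hr : FibreRefines q' q := fun x y h => (splitBy_eq h).1
  let φ : Matrix V V ℝ := fun x y => if x ∈ A ∧ y ∈ B then 1 else 0
  have hφ : BlockConst q' φ := fun x x' y y' hx hy => by
    simp only [φ, (splitBy_eq hx).2.1, (splitBy_eq hy).2.2]
  have hsum : ∀ X : Matrix V V ℝ, ∑ x ∈ A, ∑ y ∈ B, X x y = ∑ x, ∑ y, X x y * φ x y := fun X => by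
    rw [← Finset.sum_filter_add_sum_filter_not univ (· ∈ A)]
    have h0 : ∑ x with x ∉ A, ∑ y, X x y * φ x y = 0 :=
      Finset.sum_eq_zero fun x hx => Finset.sum_eq_zero fun y _ => by
        simp [φ, (mem_filter.1 hx).2]
    rw [h0, add_zero, Finset.filter_univ_mem]
    refine Finset.sum_congr rfl fun x hx => ?_
    simp [φ, hx]
  have h1 : ∑ x ∈ A, ∑ y ∈ B, (blockAvg q G x y - G x y)
      = ∑ x, ∑ y, (blockAvg q G x y - blockAvg q' G x y) * φ x y := by
    have e1 := hsum (blockAvg q G - G)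
    have e2 := sum_sum_blockAvg_mul (G := G) hφ
    simp only [Matrix.sub_apply, sub_mul, Finset.sum_sub_distrib] at e1 ⊢
    rw [e1, e2]
  have h2 : ∑ x, ∑ y, (blockAvg q G x y - blockAvg q' G x y) ^ 2
      = blockEnergy q' G - blockEnergy q G := by
    rw [← sum_sq_sub_blockAvg hr]
    exact Finset.sum_congr rfl fun _ _ => Finset.sum_congr rfl fun _ _ => by ring
  rw [h1, ← Finset.sum_product'] at hAB
  rw [← h2, ← Finset.sum_product' (f := fun x y => (blockAvg q G x y - blockAvg q' G x y) ^ 2)]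
  have h3 := Finset.sum_mul_sq_le_sq_mul_sq (univ ×ˢ univ : Finset (V × V))
    (fun z => blockAvg q G z.1 z.2 - blockAvg q' G z.1 z.2) (fun z => φ z.1 z.2)
  have h4 : ∑ z ∈ (univ ×ˢ univ : Finset (V × V)), φ z.1 z.2 ^ 2 ≤ (Fintype.card V : ℝ) ^ 2 := by
    refine (Finset.sum_le_card_nsmul _ _ 1 fun z _ => ?_).trans_eq ?_
    · simp only [φ]; split_ifs <;> norm_num
    · simp [sq]
  calc K ^ 2 ≤ _ := pow_le_pow_left₀ hK hAB.le 2
    _ ≤ _ := h3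
    _ ≤ _ := mul_le_mul_of_nonneg_left h4 (Finset.sum_nonneg fun _ _ => sq_nonneg _)
    _ = _ := mul_comm _ _

/-- Frieze–Kannan regularity relative to a given partition. -/
lemma exists_refines_cutBelow_or (q : V → ℕ) (G : Matrix V V ℝ) {K : ℝ} (hK : 0 ≤ K) (j : ℕ) :
    ∃ q', FibreRefines q' q ∧ #(univ.image q') ≤ #(univ.image q) * 4 ^ j ∧
      (CutBelow K (blockAvg q' G) G ∨
        j * K ^ 2 ≤ (Fintype.card V : ℝ) ^ 2 * (blockEnergy q' G - blockEnergy q G)) := by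
  induction j with
  | zero => exact ⟨q, fun _ _ h => h, by simp, Or.inr (by simp)⟩
  | succ j ih =>
    obtain ⟨q', hr, hc, h⟩ := ih
    have hle : #(univ.image q') ≤ #(univ.image q) * 4 ^ (j + 1) :=
      hc.trans (Nat.mul_le_mul_left _ (Nat.pow_le_pow_right (by norm_num) j.le_succ))
    by_cases hcut : CutBelow K (blockAvg q' G) G
    · exact ⟨q', hr, hle, Or.inl hcut⟩
    have h := h.resolve_left hcut
    simp only [CutBelow, not_forall, not_le] at hcut
    obtain ⟨A, B, hAB⟩ := hcut
    refine ⟨splitBy q' A B, FibreRefines.trans (fun x y h => (splitBy_eq h).1) hr, ?_, Or.inr ?_⟩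
    · exact (card_image_splitBy_le q' A B).trans
        ((Nat.mul_le_mul_right 4 hc).trans_eq (by rw [pow_succ, mul_assoc]))
    · have := blockEnergy_splitBy hK hAB
      push_cast
      linarith

/-- Sizes of the successive partitions in the strong regularity lemma. -/
noncomputable def regularityBound (κ : ℕ → ℝ) : ℕ → ℕ
  | 0 => 1
  | i + 1 => regularityBound κ i * 4 ^ (⌊2 / κ (regularityBound κ i) ^ 2⌋₊ + 1)

lemma regularityBound_mono (κ : ℕ → ℝ) : Monotone (regularityBound κ) :=
  monotone_nat_of_le_succ fun _ => Nat.le_mul_of_pos_right _ (by positivity)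

lemma regularityBound_pos (κ : ℕ → ℝ) (i : ℕ) : 0 < regularityBound κ i :=
  Nat.one_pos.trans_le (regularityBound_mono κ i.zero_le)

/-- Each failed round raises the energy by κ²|V|, while the energy stays in [0, 2|V|]; ⌊2/κ²⌋ + 1
rounds are therefore too many. -/
lemma exists_refines_cutBelow {G : Matrix V V ℝ} {κ : ℝ} (hκ : 0 < κ) {q : V → ℕ} {m : ℕ}
    (hq : #(univ.image q) ≤ m)
    (hE : ∀ q : V → ℕ, #(univ.image q) ≤ m * 4 ^ (⌊2 / κ ^ 2⌋₊ + 1) →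
      blockEnergy q G ≤ 2 * Fintype.card V) :
    ∃ q', FibreRefines q' q ∧ #(univ.image q') ≤ m * 4 ^ (⌊2 / κ ^ 2⌋₊ + 1) ∧
      CutBelow (κ * √(Fintype.card V) ^ 3) (blockAvg q' G) G := by
  obtain ⟨q', hr, hc, h⟩ := exists_refines_cutBelow_or q G
    (K := κ * √(Fintype.card V) ^ 3) (by positivity) (⌊2 / κ ^ 2⌋₊ + 1)
  replace hc := hc.trans (Nat.mul_le_mul_right _ hq)
  refine ⟨q', hr, hc, ?_⟩
  rcases isEmpty_or_nonempty V with hV | hV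
  · intro A B
    simp [Finset.eq_empty_of_isEmpty A]
  refine h.resolve_right fun h => ?_
  have hn : (0 : ℝ) < Fintype.card V := by exact_mod_cast Fintype.card_pos
  have h1 := hE q' hc
  have h2 := blockEnergy_nonneg q G
  have h3 := Nat.lt_floor_add_one (2 / κ ^ 2)
  rw [div_lt_iff₀ (by positivity)] at h3
  have h4 : (κ * √(Fintype.card V : ℝ) ^ 3) ^ 2 = κ ^ 2 * (Fintype.card V : ℝ) ^ 3 := by
    rw [mul_pow, ← pow_mul, mul_comm 3 2, pow_mul, Real.sq_sqrt hn.le]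
  rw [h4] at h
  push_cast at h
  have h5 : (2 : ℝ) * (Fintype.card V : ℝ) ^ 3
      < (⌊2 / κ ^ 2⌋₊ + 1) * κ ^ 2 * (Fintype.card V : ℝ) ^ 3 :=
    mul_lt_mul_of_pos_right h3 (by positivity)
  have h6 : (Fintype.card V : ℝ) ^ 2 * (blockEnergy q' G - blockEnergy q G)
      ≤ (Fintype.card V : ℝ) ^ 2 * (2 * Fintype.card V) :=
    mul_le_mul_of_nonneg_left (by linarith) (by positivity)
  nlinarith

/-- Strong regularity: a partition `P` and a refinement `Q` of almost the same energy, where `Q`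
approximates `G` in cut norm as well as desired in terms of the size of `P`. -/
theorem exists_strong_regular {κ : ℕ → ℝ} (hκ : ∀ m, 0 < κ m) {τ : ℝ} (hτ : 0 < τ)
    {G : Matrix V V ℝ}
    (hE : ∀ q : V → ℕ, #(univ.image q) ≤ regularityBound κ (⌊2 / τ⌋₊ + 1) →
      blockEnergy q G ≤ 2 * Fintype.card V) :
    ∃ (P Q : V → ℕ) (i : ℕ), i ≤ ⌊2 / τ⌋₊ ∧ #(univ.image P) ≤ regularityBound κ i ∧
      FibreRefines Q P ∧ blockEnergy Q G - blockEnergy P G ≤ τ * Fintype.card V ∧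
      CutBelow (κ (regularityBound κ i) * √(Fintype.card V) ^ 3) (blockAvg Q G) G := by
  by_contra! hcon
  have key : ∀ i ≤ ⌊2 / τ⌋₊ + 1, ∃ P : V → ℕ, #(univ.image P) ≤ regularityBound κ i ∧
      i * (τ * Fintype.card V) ≤ blockEnergy P G ∧
      -- Strictness after the first round gives the contradiction even for empty V, where the bound
      -- on the number of rounds is only 0 ≤ 0.
      (0 < i → i * (τ * Fintype.card V) < blockEnergy P G) := by
    intro i
    induction i with
    | zero =>
      refine fun _ => ⟨fun _ => 0, ?_, by simpa using blockEnergy_nonneg _ _, by simp⟩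
      exact (card_le_card (t := {0}) (image_subset_iff.2 fun _ _ => by simp)).trans
        (by simp [regularityBound])
    | succ i ih =>
      intro hi
      obtain ⟨P, hP, hPE, -⟩ := ih (by omega)
      obtain ⟨Q, hr, hQ, hcut⟩ := exists_refines_cutBelow (hκ (regularityBound κ i)) hP
        fun q hq => hE q (hq.trans (regularityBound_mono κ hi))
      have : τ * Fintype.card V < blockEnergy Q G - blockEnergy P G := by
        by_contra! hle
        exact hcon P Q i (by omega) hP hr hle hcut
      refine ⟨Q, hQ, ?_, fun _ => ?_⟩ <;> push_cast <;> linarith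
  obtain ⟨P, hP, -, hPE⟩ := key _ le_rfl
  have h1 := hE P hP
  have h2 := hPE (by omega)
  have h3 := Nat.lt_floor_add_one (2 / τ)
  rw [div_lt_iff₀ hτ] at h3
  push_cast at h2
  have h4 : (2 : ℝ) * Fintype.card V ≤ (⌊2 / τ⌋₊ + 1) * τ * Fintype.card V :=
    mul_le_mul_of_nonneg_right h3.le (Nat.cast_nonneg _)
  linarith

end Averaging

/-! ### Copies of cycles and excess codegrees. -/

namespace SimpleGraph

variable {V W : Type*}

lemma Copy.verts_toSubgraph {H : SimpleGraph W} {G : SimpleGraph V} (f : H.Copy G) :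
    f.toSubgraph.verts = Set.range f := by
  simp [Copy.toSubgraph]

lemma sub_trunc_nonneg {X : Matrix V V ℝ} (x y : V) : 0 ≤ X x y - X.trunc x y :=
  sub_nonneg.2 (trunc_le X x y)

lemma sub_min_one_mono {a b : ℝ} (h : a ≤ b) : a - min a 1 ≤ b - min b 1 := by
  rcases le_total a 1 with h1 | h1 <;> rcases le_total b 1 with h2 | h2 <;> (simp [*]; try linarith)

lemma adjMatrix_nonneg (G : SimpleGraph V) [DecidableRel G.Adj] (x y : V) :
    0 ≤ G.adjMatrix ℝ x y := by
  rw [adjMatrix_apply]; split_ifs <;> norm_num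

lemma adjMatrix_mono {G G' : SimpleGraph V} [DecidableRel G.Adj] [DecidableRel G'.Adj]
    (h : G ≤ G') (x y : V) : G.adjMatrix ℝ x y ≤ G'.adjMatrix ℝ x y := by
  rw [adjMatrix_apply, adjMatrix_apply]
  by_cases h1 : G.Adj x y
  · simp [h1, h h1]
  · rw [if_neg h1]; split_ifs <;> norm_num

variable [Fintype V]

/-- Two labelled copies with the same subgraph have the same vertex range, so one is the other
composed with some self-map of W. -/
lemma labelledCopyCount_le_mul_copyCount [Fintype W] (G : SimpleGraph V) (H : SimpleGraph W) :
    G.labelledCopyCount H ≤ Fintype.card W ^ Fintype.card W * G.copyCount H := by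
  classical
  rw [copyCount_eq_card_image_copyToSubgraph]
  have : G.labelledCopyCount H = #(univ : Finset (H.Copy G)) := by
    rw [labelledCopyCount, Finset.card_univ]
  rw [this]
  refine card_le_mul_card_image _ _ fun S hS => ?_
  obtain ⟨f₀, -, rfl⟩ := mem_image.1 hS
  have hex : ∀ f : H.Copy G, ∃ r : W → W, f.toSubgraph = f₀.toSubgraph → ∀ i, f i = f₀ (r i) := by
    intro f
    by_cases hf : f.toSubgraph = f₀.toSubgraph
    · have h : ∀ i, ∃ j, f i = f₀ j := fun i => by
        have hr : Set.range f = Set.range f₀ := by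
          rw [← Copy.verts_toSubgraph, hf, Copy.verts_toSubgraph]
        obtain ⟨j, hj⟩ := hr ▸ Set.mem_range_self (f := f) i
        exact ⟨j, hj.symm⟩
      choose r hr using h
      exact ⟨r, fun _ => hr⟩
    · exact ⟨id, fun h => absurd h hf⟩
  choose r hr using hex
  refine (Finset.card_le_card_of_injOn r (t := univ) (fun _ _ => mem_univ _) ?_).trans_eq ?_
  · intro f hf g hg hfg
    have hf := hr f (mem_filter.1 hf).2
    have hg := hr g (mem_filter.1 hg).2
    ext i
    rw [hf, hg, hfg]
  · simp

/-- The number of tuples tracing out an `(n + 2)`-cycle, the `i`-th vertex having colour `i`, is at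
most the number of cycles of length `n + 2`. -/
lemma card_coloured_cycles_le_copyCount (G : SimpleGraph V) {n : ℕ} (χ : V → Fin (n + 2))
    (T : Finset (Fin (n + 2) → V)) (hχ : ∀ f ∈ T, ∀ i, χ (f i) = i)
    (hadj : ∀ f ∈ T, ∀ i, G.Adj (f i) (f (i + 1))) :
    #T ≤ G.copyCount (cycleGraph (n + 2)) := by
  classical
  rw [copyCount_eq_card_image_copyToSubgraph]
  set S : Finset ((cycleGraph (n + 2)).Copy G) := univ.filter fun f => ∀ i, χ (f i) = i with hS
  have h1 : T ⊆ S.image fun (f : (cycleGraph (n + 2)).Copy G) (i : Fin (n + 2)) => f i := by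
    intro f hf
    refine mem_image.2 ⟨⟨⟨f, fun {a b} hab => ?_⟩, fun a b hab => ?_⟩, ?_, rfl⟩
    · rcases cycleGraph_adj.1 hab with h | h
      · rw [sub_eq_iff_eq_add'.1 h]
        exact (hadj f hf b).symm
      · rw [sub_eq_iff_eq_add'.1 h]
        exact hadj f hf a
    · rw [← hχ f hf a, ← hχ f hf b]
      exact congrArg χ hab
    · exact mem_filter.2 ⟨mem_univ _, hχ f hf⟩
  refine (card_le_card h1).trans (card_image_le.trans ?_)
  -- A colour-respecting copy is determined by its subgraph: position i must be the only vertex of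
  -- colour i.
  rw [← card_image_of_injOn (s := S) (f := Copy.toSubgraph)]
  · exact card_le_card (image_subset_image (subset_univ _))
  · intro f hf g hg hfg
    have hr : Set.range f = Set.range g := by
      rw [← Copy.verts_toSubgraph, ← Copy.verts_toSubgraph]
      exact congrArg Subgraph.verts hfg
    ext i
    obtain ⟨j, hj⟩ : f i ∈ Set.range g := hr ▸ Set.mem_range_self (f := f) i
    have hf := (mem_filter.1 hf).2 i
    have hg := (mem_filter.1 hg).2 j
    rw [hj] at hg
    rw [← hj, ← hg, hf]

open Classical in
/-- The number of pairs of a vertex `y ≠ x` and a common neighbour of `x` and `y`, not counting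
one common neighbour for every `y`. -/
noncomputable def pathExcess (G : SimpleGraph V) (x : V) : ℝ :=
  ∑ y ∈ univ.erase x,
    ((G.adjMatrix ℝ * G.adjMatrix ℝ) x y - (G.adjMatrix ℝ * G.adjMatrix ℝ).trunc x y)

lemma adjMatrix_mul_self_apply (G : SimpleGraph V) [DecidableRel G.Adj] (x y : V) :
    (G.adjMatrix ℝ * G.adjMatrix ℝ) x y = #{z | G.Adj x z ∧ G.Adj z y} := by
  simp [mul_apply, adjMatrix_apply, ← ite_and, Finset.sum_boole, and_comm]

lemma pathExcess_nonneg (G : SimpleGraph V) (x : V) : 0 ≤ G.pathExcess x :=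
  Finset.sum_nonneg fun y _ => sub_trunc_nonneg x y

lemma pathExcess_mono {G G' : SimpleGraph V} (h : G ≤ G') (x : V) :
    G.pathExcess x ≤ G'.pathExcess x := by
  classical
  refine Finset.sum_le_sum fun y _ => sub_min_one_mono ?_
  rw [mul_apply, mul_apply]
  exact Finset.sum_le_sum fun z _ => mul_le_mul (adjMatrix_mono h _ _) (adjMatrix_mono h _ _)
    (adjMatrix_nonneg _ _ _) (adjMatrix_nonneg _ _ _)

/-- For a codegree d, the excess d - min(d, 1) is at most d(d - 1), the number of ordered pairs of
distinct common neighbours. Together with x ≠ y such a pair is a labelled C₄; 256 is 4⁴. -/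
lemma sum_pathExcess_le (G : SimpleGraph V) :
    ∑ x, G.pathExcess x ≤ 256 * G.copyCount (cycleGraph 4) := by
  classical
  set C : V → V → Finset V := fun x y => {z | G.Adj x z ∧ G.Adj z y} with hC
  have h1 : ∑ x, G.pathExcess x ≤ ∑ x, ∑ y ∈ univ.erase x, (#(C x y).offDiag : ℝ) := by
    refine Finset.sum_le_sum fun x _ => Finset.sum_le_sum fun y _ => ?_
    have e : (G.adjMatrix ℝ * G.adjMatrix ℝ) x y = #(C x y) := by
      rw [adjMatrix_mul_self_apply]
    rw [trunc, e, offDiag_card]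
    rcases Nat.eq_zero_or_pos #(C x y) with h0 | h0
    · simp [h0]
    · rw [Nat.cast_sub (Nat.le_mul_self _), min_eq_right (by exact_mod_cast h0)]
      push_cast
      nlinarith [sq_nonneg ((#(C x y) : ℝ) - 1)]
  set S := univ.sigma fun x : V => (univ.erase x).sigma fun y => (C x y).offDiag with hS
  have h2 : ∑ x, ∑ y ∈ univ.erase x, (#(C x y).offDiag : ℝ) = #S := by
    simp [hS, card_sigma]
  have h3 : #S ≤ G.labelledCopyCount (cycleGraph 4) := by
    have : G.labelledCopyCount (cycleGraph 4) = #(univ : Finset ((cycleGraph 4).Copy G)) := by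
      rw [labelledCopyCount, Finset.card_univ]
      convert rfl
    rw [this]
    refine le_trans ?_ (card_image_le (f := fun f : (cycleGraph 4).Copy G => (f : Fin 4 → V)))
    refine Finset.card_le_card_of_injOn (fun t => ![t.1, t.2.2.1, t.2.1, t.2.2.2]) ?_ ?_
    · rintro ⟨x, y, z, w⟩ ht
      simp only [hS, hC, coe_sigma, Set.mem_sigma_iff, mem_coe, mem_univ, mem_erase, mem_offDiag,
        mem_filter, true_and, and_true] at ht
      obtain ⟨hyx, ⟨hxz, hzy⟩, ⟨hxw, hwy⟩, hzw⟩ := ht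
      refine mem_coe.2 (mem_image.2 ⟨⟨⟨![x, z, y, w], fun {a b} hab => ?_⟩, ?_⟩, mem_univ _, rfl⟩)
      · fin_cases a <;> fin_cases b <;> first
          | exact absurd hab (by decide)
          | exact hxz | exact hxz.symm | exact hzy | exact hzy.symm
          | exact hxw | exact hxw.symm | exact hwy | exact hwy.symm
      · intro a b hab
        fin_cases a <;> fin_cases b <;> first
          | rfl
          | exact absurd hab hyx | exact absurd hab hyx.symm
          | exact absurd hab hzw | exact absurd hab hzw.symm
          | exact absurd hab hxz.ne | exact absurd hab hxz.ne' | exact absurd hab hzy.ne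
          | exact absurd hab hzy.ne' | exact absurd hab hxw.ne | exact absurd hab hxw.ne'
          | exact absurd hab hwy.ne | exact absurd hab hwy.ne'
    · rintro ⟨x, y, z, w⟩ - ⟨x', y', z', w'⟩ - h
      have e0 := congrFun h 0
      have e1 := congrFun h 1
      have e2 := congrFun h 2
      have e3 := congrFun h 3
      simp at e0 e1 e2 e3
      subst e0 e1 e2 e3
      rfl
  have h4 := h3.trans (labelledCopyCount_le_mul_copyCount G (cycleGraph 4))
  simp only [Fintype.card_fin] at h4
  rw [h2] at h1
  refine h1.trans ?_
  norm_num at h4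
  exact_mod_cast h4

end SimpleGraph

/-! ### Finding pentagons inside a closed walk of good blocks. -/

lemma trace_mul_five {V : Type*} [Fintype V] (X : Fin 5 → Matrix V V ℝ) :
    (X 0 * X 1 * X 2 * X 3 * X 4).trace = ∑ f : Fin 5 → V, ∏ i, X i (f i) (f (i + 1)) := by
  -- The order 0, 4, 3, 2, 1 is that of the nested sums in the left-associated product.
  let e : (Fin 5 → V) ≃ V × V × V × V × V :=
    { toFun := fun f => (f 0, f 4, f 3, f 2, f 1)
      invFun := fun t => ![t.1, t.2.2.2.2, t.2.2.2.1, t.2.2.1, t.2.1]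
      left_inv := fun f => by ext i; fin_cases i <;> rfl
      right_inv := fun _ => rfl }
  rw [← e.symm.sum_comp]
  simp only [Fintype.sum_prod_type, trace, diag_apply, mul_apply, Finset.sum_mul,
    Fin.prod_univ_five]
  rfl

/-- A union bound for cyclically consecutive coordinates in a product of five sets. -/
lemma card_piFinset_le_two_mul {V : Type*} [DecidableEq V] (W : Fin 5 → Finset V)
    (B : Fin 5 → V → V → Prop) [∀ i x y, Decidable (B i x y)]
    (hB : ∀ i, 10 * #{z ∈ W i ×ˢ W (i + 1) | B i z.1 z.2} ≤ #(W i) * #(W (i + 1))) :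
    #(Fintype.piFinset W) ≤ 2 * #{f ∈ Fintype.piFinset W | ∀ i, ¬ B i (f i) (f (i + 1))} := by
  have hbad : ∀ i, 10 * #{f ∈ Fintype.piFinset W | B i (f i) (f (i + 1))}
      ≤ #(Fintype.piFinset W) := by
    intro i
    have hi : i + 1 ≠ i := by simp
    rcases Nat.eq_zero_or_pos (#(W i) * #(W (i + 1))) with h0 | h0
    · have : Fintype.piFinset W = ∅ := by
        rw [← card_eq_zero, Fintype.card_piFinset]
        rcases Nat.mul_eq_zero.1 h0 with h | h <;> exact prod_eq_zero (mem_univ _) h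
      simp [this]
    -- Exchanging coordinates i and i + 1 with a free pair (u, v) is injective. It shows that the
    -- bad tuples have the same density as the bad pairs, at most 1/10.
    have hinj : #({f ∈ Fintype.piFinset W | B i (f i) (f (i + 1))} ×ˢ (W i ×ˢ W (i + 1)))
        ≤ #({z ∈ W i ×ˢ W (i + 1) | B i z.1 z.2} ×ˢ Fintype.piFinset W) := by
      refine card_le_card_of_injOn (fun t => ((t.1 i, t.1 (i + 1)),
        Function.update (Function.update t.1 i t.2.1) (i + 1) t.2.2)) ?_ ?_
      · rintro ⟨f, u, v⟩ h
        simp only [coe_product, coe_filter, Set.mem_prod, mem_coe, Set.mem_ofPred_eq,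
          Fintype.mem_piFinset, mem_product] at h ⊢
        refine ⟨⟨⟨h.1.1 i, h.1.1 (i + 1)⟩, h.1.2⟩, fun j => ?_⟩
        rcases eq_or_ne j (i + 1) with rfl | hj
        · simpa using h.2.2
        rw [Function.update_of_ne hj]
        rcases eq_or_ne j i with rfl | hj'
        · simpa using h.2.1
        · rw [Function.update_of_ne hj']; exact h.1.1 j
      · rintro ⟨f, u, v⟩ - ⟨f', u', v'⟩ - h
        simp only [Prod.mk.injEq] at h
        obtain ⟨⟨h1, h2⟩, h3⟩ := h
        have hv := congrFun h3 (i + 1)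
        have hu := congrFun h3 i
        simp only [Function.update_self, Function.update_of_ne hi.symm] at hu hv
        subst hu hv
        refine Prod.ext (funext fun j => ?_) rfl
        rcases eq_or_ne j (i + 1) with rfl | hj
        · exact h2
        rcases eq_or_ne j i with rfl | hj'
        · exact h1
        · simpa [Function.update_of_ne hj, Function.update_of_ne hj'] using congrFun h3 j
    rw [card_product, card_product, card_product] at hinj
    refine Nat.le_of_mul_le_mul_right ?_ h0
    calc _ = 10 * (#{f ∈ Fintype.piFinset W | B i (f i) (f (i + 1))} * (#(W i) * #(W (i + 1)))) := by
          ring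
      _ ≤ 10 * (#{z ∈ W i ×ˢ W (i + 1) | B i z.1 z.2} * #(Fintype.piFinset W)) :=
          Nat.mul_le_mul_left _ hinj
      _ = 10 * #{z ∈ W i ×ˢ W (i + 1) | B i z.1 z.2} * #(Fintype.piFinset W) := by ring
      _ ≤ _ := (Nat.mul_le_mul_right _ (hB i)).trans_eq (mul_comm _ _)
  have hcover : Fintype.piFinset W ⊆
      {f ∈ Fintype.piFinset W | ∀ i, ¬ B i (f i) (f (i + 1))} ∪
        univ.biUnion fun i => {f ∈ Fintype.piFinset W | B i (f i) (f (i + 1))} := by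
    intro f hf
    by_cases h : ∀ i, ¬ B i (f i) (f (i + 1))
    · exact mem_union_left _ (mem_filter.2 ⟨hf, h⟩)
    · push Not at h
      obtain ⟨i, hi⟩ := h
      exact mem_union_right _ (mem_biUnion.2 ⟨i, mem_univ _, mem_filter.2 ⟨hf, hi⟩⟩)
  have h1 := (card_le_card hcover).trans (card_union_le _ _)
  have h2 := card_biUnion_le (s := univ)
    (t := fun i => {f ∈ Fintype.piFinset W | B i (f i) (f (i + 1))})
  have h3 : 10 * ∑ i, #{f ∈ Fintype.piFinset W | B i (f i) (f (i + 1))}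
      ≤ 5 * #(Fintype.piFinset W) := by
    rw [Finset.mul_sum]
    exact (Finset.sum_le_sum fun i _ => hbad i).trans_eq (by simp)
  omega

/-- Any test rectangle can be shrunk to S × T, so a cut bound passes to a pair of parts. Being
one-sided, it also survives lowering f to β times an indicator. -/
lemma CutBelow.restrict {V : Type*} {K β : ℝ} {f A : Matrix V V ℝ} (h : CutBelow K f A)
    {S T : Finset V} {s g : Matrix V V ℝ}
    (hin : ∀ x ∈ S, ∀ y ∈ T, β * s x y ≤ f x y ∧ A x y ≤ g x y)
    (hout : ∀ x y, ¬ (x ∈ S ∧ y ∈ T) → s x y = 0 ∧ 0 ≤ g x y) :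
    CutBelow K (β • s) g := by
  classical
  intro X Y
  refine le_trans ?_ (h (X ∩ S) (Y ∩ T))
  rw [← Finset.filter_mem_eq_inter, ← Finset.filter_mem_eq_inter, Finset.sum_filter]
  refine Finset.sum_le_sum fun x _ => ?_
  split_ifs with hx
  · rw [Finset.sum_filter]
    refine Finset.sum_le_sum fun y _ => ?_
    split_ifs with hy
    · exact sub_le_sub (hin x hx y hy).1 (hin x hx y hy).2
    · have := hout x y fun h => hy h.2
      simp [this.1, this.2]
  · refine Finset.sum_nonpos fun y _ => ?_
    have := hout x y fun h => hx h.1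
    simp [this.1, this.2]

/-- The fibres of `q` can be coloured in a balanced way with five colours. -/
lemma exists_balanced_colouring {V : Type*} [Fintype V] (q : V → ℕ) :
    ∃ χ : V → Fin 5, ∀ x i, 5 ≤ fibreCard q x →
      fibreCard q x ≤ 10 * #{y | q y = q x ∧ χ y = i} := by
  classical
  let S : ℕ → Finset V := fun c => {y | q y = c}
  have hS : ∀ y, y ∈ S (q y) := fun y => by simp [S]
  -- Number each fibre and colour by the index mod 5. A fibre of size N then has at least ⌊N/5⌋
  -- vertices of each colour, which is at least N/10 once N ≥ 5.
  let χ : V → Fin 5 := fun y => Fin.ofNat 5 ((S (q y)).equivFin ⟨y, hS y⟩)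
  refine ⟨χ, fun x i hx => ?_⟩
  have hcard : fibreCard q x = #(S (q x)) := rfl
  have hlt : ∀ k : Fin (fibreCard q x / 5), 5 * (k : ℕ) + i < #(S (q x)) := fun k => by
    have := k.2
    have := i.2
    omega
  have key : Fintype.card (Fin (fibreCard q x / 5)) ≤ #{y | q y = q x ∧ χ y = i} := by
    refine Finset.card_le_card_of_injOn
      (fun k => ((S (q x)).equivFin.symm ⟨5 * (k : ℕ) + i, hlt k⟩ : V)) ?_ ?_
    · intro k _
      set y := (S (q x)).equivFin.symm ⟨5 * (k : ℕ) + i, hlt k⟩ with hy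
      have hq : q y = q x := (mem_filter.1 y.2).2
      refine mem_coe.2 (mem_filter.2 ⟨mem_univ _, hq, ?_⟩)
      have hgen : ∀ c, (h : c = q x) → ∀ hm : (y : V) ∈ S c,
          (((S c).equivFin ⟨y, hm⟩ : Fin _) : ℕ) = 5 * k + i := by
        rintro c rfl hm
        have : (⟨y, hm⟩ : S (q x)) = y := rfl
        rw [this, hy, Equiv.apply_symm_apply]
      ext
      have e : ((χ y : Fin 5) : ℕ) = ((S (q y)).equivFin ⟨y, hS y⟩ : ℕ) % 5 := rfl
      have := i.2
      rw [e, hgen _ hq]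
      omega
    · intro k _ l _ h
      have := (S (q x)).equivFin.symm.injective (Subtype.ext h)
      simp only [Fin.mk.injEq] at this
      ext
      omega
  rw [Fintype.card_fin] at key
  omega

section

variable {V : Type*} [Fintype V]

/-- If the average of `b` over a block is small then its sum over any part of the block is. -/
lemma sum_le_of_blockAvg_le {q : V → ℕ} {b : Matrix V V ℝ} (hb : ∀ x y, 0 ≤ b x y) {θ : ℝ}
    {x y : V} (h : blockAvg q b x y ≤ θ) {S T : Finset V} (hS : ∀ u ∈ S, q u = q x)
    (hT : ∀ u ∈ T, q u = q y) :
    ∑ u ∈ S, ∑ v ∈ T, b u v ≤ θ * (fibreCard q x * fibreCard q y) := by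
  have hx : (0 : ℝ) < fibreCard q x := by exact_mod_cast fibreCard_pos q x
  have hy : (0 : ℝ) < fibreCard q y := by exact_mod_cast fibreCard_pos q y
  rw [← div_le_iff₀ (mul_pos hx hy)]
  refine le_trans ?_ h
  have h1 : ∀ u ∈ S, (fibreCard q x : ℝ)⁻¹ * ∑ v ∈ T, b u v * (fibreCard q y : ℝ)⁻¹
      ≤ avgMatrix q x u * (b * avgMatrix q) u y := by
    intro u hu
    have : avgMatrix q x u = (fibreCard q x : ℝ)⁻¹ := if_pos (hS u hu)
    rw [this, mul_apply]
    refine mul_le_mul_of_nonneg_left ?_ (inv_nonneg.2 hx.le)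
    refine (Finset.sum_le_sum fun v hv => ?_).trans (Finset.sum_le_sum_of_subset_of_nonneg
      (subset_univ T) fun v _ _ => mul_nonneg (hb u v) (avgMatrix_nonneg q v y))
    rw [avgMatrix, if_pos (hT v hv).symm, fibreCard_congr (hT v hv)]
  have h2 := Finset.sum_le_sum h1
  refine le_trans (le_of_eq ?_) (h2.trans (Finset.sum_le_sum_of_subset_of_nonneg (subset_univ S)
      fun u _ _ => mul_nonneg (avgMatrix_nonneg q x u)
        (mul_apply_nonneg hb (avgMatrix_nonneg q) u y)))
  rw [Finset.sum_div]
  refine Finset.sum_congr rfl fun u _ => ?_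
  rw [← Finset.sum_mul]
  field_simp

end

section

variable {V : Type*}

open Classical in
/-- The indicator of the pairs on which `f` is less than `β`. -/
noncomputable def belowIndicator (f : Matrix V V ℝ) (β : ℝ) : Matrix V V ℝ :=
  fun x y => if f x y < β then 1 else 0

lemma belowIndicator_nonneg (f : Matrix V V ℝ) (β : ℝ) (x y : V) :
    0 ≤ belowIndicator f β x y := by
  unfold belowIndicator; split_ifs <;> norm_num

open Classical in
lemma sum_prod_boole {α ι : Type*} [Fintype α] [Fintype ι] (q : α → ι → Prop)
    [∀ a i, Decidable (q a i)] :
    ∑ a, ∏ i, (if q a i then (1 : ℝ) else 0) = #{a | ∀ i, q a i} := by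
  rw [← Finset.sum_boole]
  refine Finset.sum_congr rfl fun a _ => ?_
  rw [Finset.prod_boole]
  simp

variable [Fintype V]

open Classical in
/-- The number of pentagons in a graph of bounded degree with few excess paths of length two, that
is well approximated by a step function which is large on most of the blocks of a closed walk of
length five. -/
theorem le_copyCount_cycleGraph_five {G G' : SimpleGraph V} (hGG' : G ≤ G')
    {r γ κ a η : ℝ} (hr : 0 < r)
    (hn : (Fintype.card V : ℝ) = r ^ 2) (hγ : 0 ≤ γ) (hκ : 0 ≤ κ) (ha : 0 < a) (ha1 : a ≤ 1)
    (hη : 0 < η) (hηr : 5 ≤ η * r ^ 2)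
    (hdeg : ∀ x, ∑ y, G.adjMatrix ℝ x y ≤ 2 * r)
    (hexc : ∀ x, ∑ y, ((G.adjMatrix ℝ * G.adjMatrix ℝ) x y
      - (G.adjMatrix ℝ * G.adjMatrix ℝ).trunc x y) ≤ 2 * γ * r ^ 2)
    {P Q : V → ℕ} (hcut : CutBelow (κ * r ^ 3) (blockAvg Q (G.adjMatrix ℝ)) (G.adjMatrix ℝ))
    {p : Fin 5 → V} (hp : ∀ i, η * r ^ 2 ≤ fibreCard P (p i))
    (hb : ∀ i, blockAvg P (belowIndicator (blockAvg Q (G.adjMatrix ℝ)) (a / r))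
      (p i) (p (i + 1)) ≤ 1 / 1000) :
    (a ^ 5 * (η / 10) ^ 5 / 2 - 10 * κ - 20 * γ) * r ^ 5
      ≤ G'.copyCount (SimpleGraph.cycleGraph 5) := by
  set A := G.adjMatrix ℝ with hA
  set f := blockAvg Q A with hf
  have hA0 : ∀ x y, 0 ≤ A x y := SimpleGraph.adjMatrix_nonneg G
  have hAs : ∀ x y, A x y = A y x := fun x y => by simp [hA, SimpleGraph.adjMatrix_apply, G.adj_comm]
  obtain ⟨χ, hχ⟩ := exists_balanced_colouring P
  -- The p i may share fibres, as they do on a walk coming from a triangle; the colours keep the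
  -- five parts disjoint.
  let W : Fin 5 → Finset V := fun i => {y | P y = P (p i) ∧ χ y = i}
  have hWP : ∀ i, ∀ y ∈ W i, P y = P (p i) := fun i y hy => (mem_filter.1 hy).2.1
  have hWχ : ∀ i, ∀ y ∈ W i, χ y = i := fun i y hy => (mem_filter.1 hy).2.2
  have hWc : ∀ i, (fibreCard P (p i) : ℝ) ≤ 10 * #(W i) := fun i => by
    have h5 : 5 ≤ fibreCard P (p i) := by exact_mod_cast hηr.trans (hp i)
    exact_mod_cast hχ (p i) i h5
  let g : Fin 5 → Matrix V V ℝ := fun i x y =>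
    if x ∈ W i ∧ y ∈ W (i + 1) ∧ G.Adj x y then 1 else 0
  let s : Fin 5 → Matrix V V ℝ := fun i x y =>
    if x ∈ W i ∧ y ∈ W (i + 1) ∧ ¬ f x y < a / r then 1 else 0
  have hg0 : ∀ i x y, 0 ≤ g i x y := fun i x y => by simp only [g]; split_ifs <;> norm_num
  have hgA : ∀ i x y, g i x y ≤ A x y := fun i x y => by
    simp only [g, hA, SimpleGraph.adjMatrix_apply]
    by_cases h : G.Adj x y
    · simp only [h, if_true]; split_ifs <;> norm_num
    · simp [h]
  have hs01 : ∀ i x y, s i x y ∈ Set.Icc (0 : ℝ) 1 := fun i x y => by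
    simp only [s]; split_ifs <;> norm_num
  have hline : ∀ i, (g i).LineSumLE (2 * r) := fun i =>
    ⟨fun x => (Finset.sum_le_sum fun y _ => hgA i x y).trans (hdeg x),
      fun y => (Finset.sum_le_sum fun x _ => (hgA i x y).trans_eq (hAs x y)).trans (hdeg y)⟩
  have hcuts : ∀ i, CutBelow (κ * r ^ 3) ((a / r) • s i) (g i) := fun i => by
    refine hcut.restrict (S := W i) (T := W (i + 1)) (fun x hx y hy => ⟨?_, ?_⟩) fun x y h => ?_
    · simp only [s, hx, hy, true_and]
      by_cases h : f x y < a / r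
      · simpa [h] using blockAvg_nonneg Q hA0 x y
      · simpa [h] using not_lt.1 h
    · simp [g, hx, hy, hA, SimpleGraph.adjMatrix_apply]
    · refine ⟨if_neg fun h' => h ⟨h'.1, h'.2.1⟩, hg0 i x y⟩
  have hE : ∀ i j, ∑ x, ∑ y, ((g i * g j) x y - (g i * g j).trunc x y)
      ≤ r ^ 2 * (2 * γ * r ^ 2) := fun i j => by
    refine (Finset.sum_le_sum fun x _ => ((Finset.sum_le_sum fun y _ =>
      SimpleGraph.sub_min_one_mono ?_).trans (hexc x))).trans_eq (by simp [hn])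
    rw [mul_apply, mul_apply]
    exact Finset.sum_le_sum fun z _ => mul_le_mul (hgA i x z) (hgA j z y) (hg0 j z y) (hA0 x z)
  have main := pentagon_counting (n := r ^ 2) (K := κ * r ^ 3) (D := 2 * r) (Γ := 2 * γ * r ^ 2)
    (β := a / r) hn.symm (by positivity) (by positivity) (hg0 0) (hg0 1) (hg0 2) (hg0 3) (hg0 4)
    (hs01 0) (hs01 1) (hs01 2) (hs01 4) (hline 0) (hline 1) (hline 3) (hline 4)
    (hcuts 0) (hcuts 1) (hcuts 2) (hcuts 3) (hcuts 4) (hE 0 1) (hE 3 4)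
  rw [trace_mul_five, trace_mul_five] at main
  have hT : ∑ z : Fin 5 → V, ∏ i, g i (z i) (z (i + 1))
      ≤ G'.copyCount (SimpleGraph.cycleGraph 5) := by
    refine (sum_prod_boole fun (z : Fin 5 → V) i =>
      z i ∈ W i ∧ z (i + 1) ∈ W (i + 1) ∧ G.Adj (z i) (z (i + 1))).trans_le
      (Nat.cast_le.2 (G'.card_coloured_cycles_le_copyCount χ _ ?_ ?_))
    · intro z hz i
      simp only [mem_filter, mem_univ, true_and] at hz
      exact hWχ i _ (hz i).1
    · intro z hz i
      simp only [mem_filter, mem_univ, true_and] at hz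
      exact hGG' (hz i).2.2
  -- Passing from a fibre to `W i` costs a factor 10 on each side, and the union bound needs density
  -- 1/10, hence the threshold 1/1000.
  have hB : ∀ i, 10 * #{z ∈ W i ×ˢ W (i + 1) | f z.1 z.2 < a / r} ≤ #(W i) * #(W (i + 1)) := by
    intro i
    have h1 := sum_le_of_blockAvg_le (belowIndicator_nonneg f (a / r)) (hb i)
      (hWP i) (hWP (i + 1))
    have h2 : ∑ u ∈ W i, ∑ v ∈ W (i + 1), belowIndicator f (a / r) u v
        = #{z ∈ W i ×ˢ W (i + 1) | f z.1 z.2 < a / r} := by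
      refine (Finset.sum_product' _ _ fun u v => belowIndicator f (a / r) u v).symm.trans ?_
      simp only [belowIndicator, Finset.sum_boole]
    rw [h2] at h1
    have h3 := mul_le_mul (hWc i) (hWc (i + 1)) (Nat.cast_nonneg _) (by positivity)
    have h4 : (10 : ℝ) * #{z ∈ W i ×ˢ W (i + 1) | f z.1 z.2 < a / r}
        ≤ #(W i) * #(W (i + 1)) := by linarith
    exact_mod_cast h4
  have hR : 1 / 2 * (η * r ^ 2 / 10) ^ 5 ≤ ∑ z : Fin 5 → V, ∏ i, s i (z i) (z (i + 1)) := by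
    have h1 := card_piFinset_le_two_mul W (fun _ x y => f x y < a / r) hB
    have h2 : ∑ z : Fin 5 → V, ∏ i, s i (z i) (z (i + 1))
        = #{z ∈ Fintype.piFinset W | ∀ i, ¬ f (z i) (z (i + 1)) < a / r} := by
      refine (sum_prod_boole fun (z : Fin 5 → V) i =>
        z i ∈ W i ∧ z (i + 1) ∈ W (i + 1) ∧ ¬ f (z i) (z (i + 1)) < a / r).trans ?_
      refine congrArg (fun T : Finset (Fin 5 → V) => (#T : ℝ)) (Finset.ext fun z => ?_)
      simp only [mem_filter, mem_univ, true_and, Fintype.mem_piFinset]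
      exact ⟨fun h => ⟨fun i => (h i).1, fun i => (h i).2.2⟩,
        fun h i => ⟨h.1 i, h.1 (i + 1), h.2 i⟩⟩
    have h3 : (η * r ^ 2 / 10) ^ 5 ≤ #(Fintype.piFinset W) := by
      rw [Fintype.card_piFinset, Nat.cast_prod]
      refine le_trans (by simp [div_pow]) (Finset.prod_le_prod (s := univ)
        (f := fun _ : Fin 5 => η * r ^ 2 / 10) (fun _ _ => by positivity) fun i _ => ?_)
      have := hp i
      have := hWc i
      linarith
    rw [h2]
    have h4 : (#(Fintype.piFinset W) : ℝ)
        ≤ 2 * #{z ∈ Fintype.piFinset W | ∀ i, ¬ f (z i) (z (i + 1)) < a / r} := by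
      exact_mod_cast h1
    linarith
  have hmul := mul_le_mul_of_nonneg_left hR (pow_nonneg (div_nonneg ha.le hr.le) 5)
  have e1 : (a / r) ^ 5 * (1 / 2 * (η * r ^ 2 / 10) ^ 5) = a ^ 5 * (η / 10) ^ 5 / 2 * r ^ 5 := by
    field_simp
  -- With β = a/r, D = 2r, K = κr³ and Γ = 2γr², every error term has order r⁵, like the main term.
  have e2 : (a / r) ^ 4 * (r ^ 2) ^ 3 * (κ * r ^ 3) + (a / r) ^ 3 * (r ^ 2) ^ 2 * (2 * r) * (κ * r ^ 3)
      + (a / r) ^ 2 * r ^ 2 * (2 * r) ^ 2 * (κ * r ^ 3) + a / r * r ^ 2 * (2 * r) * (κ * r ^ 3)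
      + r ^ 2 * (κ * r ^ 3) + (a / r) ^ 2 * (r ^ 2) ^ 2 * (2 * r) * (2 * γ * r ^ 2)
      + 2 * (a / r) * r ^ 2 * (2 * r) ^ 2 * (2 * γ * r ^ 2)
      = ((a ^ 4 + 2 * a ^ 3 + 4 * a ^ 2 + 2 * a + 1) * κ + (4 * a ^ 2 + 16 * a) * γ) * r ^ 5 := by
    field_simp
    ring
  rw [e2] at main
  have p2 : a ^ 2 ≤ 1 := pow_le_one₀ ha.le ha1
  have p3 : a ^ 3 ≤ 1 := pow_le_one₀ ha.le ha1
  have p4 : a ^ 4 ≤ 1 := pow_le_one₀ ha.le ha1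
  have e3 : (a ^ 4 + 2 * a ^ 3 + 4 * a ^ 2 + 2 * a + 1) * κ + (4 * a ^ 2 + 16 * a) * γ
      ≤ 10 * κ + 20 * γ :=
    add_le_add (mul_le_mul_of_nonneg_right (by linarith) hκ)
      (mul_le_mul_of_nonneg_right (by linarith) hγ)
  have e4 := mul_le_mul_of_nonneg_right e3 (pow_nonneg hr.le 5)
  linarith

end

/-! ### Counting deleted edges and cleaning the graph. -/

open Classical in
/-- The number of ordered pairs adjacent in `G` and related by `R`, as a real number. -/
noncomputable def adjCount {V : Type*} [Fintype V] (G : SimpleGraph V) (R : V → V → Prop) : ℝ :=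
  ∑ x, ∑ y, if G.Adj x y ∧ R x y then 1 else 0

section

variable {V : Type*} [Fintype V]

lemma adjCount_mono {G : SimpleGraph V} {R S : V → V → Prop}
    (h : ∀ x y, G.Adj x y → R x y → S x y) : adjCount G R ≤ adjCount G S := by
  classical
  refine Finset.sum_le_sum fun x _ => Finset.sum_le_sum fun y _ => ?_
  by_cases h1 : G.Adj x y ∧ R x y
  · rw [if_pos h1, if_pos ⟨h1.1, h x y h1.1 h1.2⟩]
  · rw [if_neg h1]; split_ifs <;> norm_num

lemma adjCount_or_le (G : SimpleGraph V) (R S : V → V → Prop) :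
    adjCount G (fun x y => R x y ∨ S x y) ≤ adjCount G R + adjCount G S := by
  classical
  simp only [adjCount, ← Finset.sum_add_distrib]
  refine Finset.sum_le_sum fun x _ => Finset.sum_le_sum fun y _ => ?_
  by_cases h : G.Adj x y <;> by_cases h1 : R x y <;> by_cases h2 : S x y <;> simp [h, h1, h2]

lemma adjCount_swap (G : SimpleGraph V) (R : V → V → Prop) :
    adjCount G (fun x y => R y x) = adjCount G R := by
  classical
  simp only [adjCount]
  rw [Finset.sum_comm]
  simp only [G.adj_comm]

open Classical in
lemma adjCount_eq_sum_mul (G : SimpleGraph V) (R : V → V → Prop) :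
    adjCount G R = ∑ x, ∑ y, G.adjMatrix ℝ x y * (if R x y then 1 else 0) := by
  refine Finset.sum_congr rfl fun x _ => Finset.sum_congr rfl fun y _ => ?_
  rw [SimpleGraph.adjMatrix_apply]
  by_cases h : G.Adj x y <;> simp [h]

open Classical in
lemma adjCount_left (G : SimpleGraph V) (S : Finset V) :
    adjCount G (fun x _ => x ∈ S) = ∑ x ∈ S, ∑ y, G.adjMatrix ℝ x y := by
  rw [adjCount_eq_sum_mul, ← Finset.sum_filter_add_sum_filter_not univ (· ∈ S),
    Finset.filter_univ_mem]
  refine (add_eq_left.2 (Finset.sum_eq_zero fun x hx => ?_)).trans ?_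
  · simp [(mem_filter.1 hx).2]
  · exact Finset.sum_congr rfl fun x hx => by simp [hx]

lemma exists_finset_deleteEdges {G G' : SimpleGraph V} (h : G' ≤ G) :
    ∃ E : Finset (Sym2 V), (E : Set (Sym2 V)) ⊆ G.edgeSet ∧
      (#E : ℝ) ≤ adjCount G (fun x y => ¬ G'.Adj x y) ∧
      G.deleteEdges (E : Set (Sym2 V)) = G' := by
  classical
  let E : Finset (Sym2 V) := {z | z ∈ G.edgeSet \ G'.edgeSet}
  have hE : (E : Set (Sym2 V)) = G.edgeSet \ G'.edgeSet := by ext; simp [E]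
  refine ⟨E, hE ▸ Set.sdiff_subset, ?_, ?_⟩
  · have h1 : E ⊆ ({z : V × V | G.Adj z.1 z.2 ∧ ¬ G'.Adj z.1 z.2} : Finset (V × V)).image
        fun z => s(z.1, z.2) := by
      intro z hz
      induction z with
      | _ x y =>
        refine mem_image.2 ⟨(x, y), mem_filter.2 ⟨mem_univ _, ?_⟩, rfl⟩
        simpa [E] using hz
    have h2 := (card_le_card h1).trans card_image_le
    refine (Nat.cast_le.2 h2).trans_eq ?_
    rw [adjCount, ← Finset.sum_boole, Fintype.sum_prod_type]
    exact Finset.sum_congr rfl fun x _ => Finset.sum_congr rfl fun y _ => by congr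
  · ext x y
    rw [SimpleGraph.deleteEdges_adj, hE]
    simp only [Set.mem_sdiff, SimpleGraph.mem_edgeSet, not_and, not_not]
    exact ⟨fun h' => h'.2 h'.1, fun h' => ⟨h h', fun _ => h'⟩⟩

lemma SimpleGraph.adjMatrix_mul_self_diag (G : SimpleGraph V) [DecidableRel G.Adj] (x : V) :
    (G.adjMatrix ℝ * G.adjMatrix ℝ) x x = ∑ y, G.adjMatrix ℝ x y := by
  rw [mul_apply]
  refine Finset.sum_congr rfl fun y _ => ?_
  simp only [SimpleGraph.adjMatrix_apply, G.adj_comm y x]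
  split_ifs <;> norm_num

open Classical in
/-- The total degree of the vertices of degree more than `2√n` is small. -/
lemma sum_degree_high_le (G : SimpleGraph V) {r ε δ : ℝ} (hr : 0 < r)
    (hn : (Fintype.card V : ℝ) = r ^ 2) (hε : 0 < ε) (hδ : 4 * δ ≤ ε ^ 2) (hεr : 4 ≤ ε * r)
    (hL : ∑ x, G.pathExcess x ≤ δ * r ^ 4) {S : Finset V}
    (hS : ∀ x ∈ S, 2 * r ≤ ∑ y, G.adjMatrix ℝ x y) :
    ∑ x ∈ S, ∑ y, G.adjMatrix ℝ x y ≤ ε * r ^ 3 := by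
  set A := G.adjMatrix ℝ with hA
  set e := ∑ x ∈ S, ∑ y, A x y with he
  have hSe : #S * (2 * r) ≤ e := by
    simpa using Finset.card_nsmul_le_sum S _ _ hS
  have hdiag : ∀ x, (A * A) x x = ∑ y, A x y := G.adjMatrix_mul_self_diag
  -- Cauchy–Schwarz over the other endpoint w bounds e² by n times the sum of codegrees over S × S.
  -- That sum is at most e (the diagonal) plus |S|² plus the total excess.
  have h1 : e ^ 2 ≤ r ^ 2 * ∑ w, (∑ x ∈ S, A x w) ^ 2 := by
    have : e = ∑ w, ∑ x ∈ S, A x w := Finset.sum_comm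
    rw [this, ← hn]
    exact sq_sum_le_card_mul_sum_sq
  have h2 : ∑ w, (∑ x ∈ S, A x w) ^ 2 = ∑ x ∈ S, ∑ y ∈ S, (A * A) x y := by
    simp only [sq, Finset.sum_mul_sum, mul_apply]
    rw [Finset.sum_comm]
    refine Finset.sum_congr rfl fun x _ => ?_
    rw [Finset.sum_comm]
    refine Finset.sum_congr rfl fun y _ => Finset.sum_congr rfl fun z _ => ?_
    simp only [hA, SimpleGraph.adjMatrix_apply, G.adj_comm y z]
  have h3 : ∀ x ∈ S, ∑ y ∈ S, (A * A) x y ≤ ∑ y, A x y + (#S + G.pathExcess x) := by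
    intro x hx
    rw [← Finset.add_sum_erase S _ hx, hdiag]
    refine add_le_add_right ?_ _
    have h4 : ∀ y ∈ S.erase x, (A * A) x y ≤ 1 + ((A * A) x y - (A * A).trunc x y) := fun y _ => by
      have : (A * A).trunc x y ≤ 1 := min_le_right _ _
      linarith
    refine (Finset.sum_le_sum h4).trans ?_
    rw [Finset.sum_add_distrib]
    refine add_le_add ?_ ?_
    · simpa using card_le_card (erase_subset x S)
    · exact Finset.sum_le_sum_of_subset_of_nonneg (erase_subset_erase x (subset_univ S))
        fun y _ _ => SimpleGraph.sub_trunc_nonneg x y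
  have h5 : ∑ x ∈ S, ∑ y ∈ S, (A * A) x y ≤ e + (#S * #S + δ * r ^ 4) := by
    refine (Finset.sum_le_sum h3).trans ?_
    rw [Finset.sum_add_distrib, Finset.sum_add_distrib, Finset.sum_const, nsmul_eq_mul]
    refine add_le_add_right (add_le_add_right ?_ _) _
    exact (Finset.sum_le_sum_of_subset_of_nonneg (subset_univ S)
      fun x _ _ => G.pathExcess_nonneg x).trans hL
  rw [h2] at h1
  -- If e > εr³, each of the three contributions is at most e²/4. For |S|² this is where the degree
  -- threshold 2r enters.
  by_contra! hlt
  have hpos : 0 < ε * r ^ 3 := by positivity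
  have he0 : 0 < e := hpos.trans hlt
  have h6 : r ^ 2 * e ≤ e ^ 2 / 4 := by
    have : r ^ 2 * 4 ≤ e := by nlinarith [sq_nonneg r]
    nlinarith
  have h7 : r ^ 2 * (#S * #S : ℝ) ≤ e ^ 2 / 4 := by
    have := pow_le_pow_left₀ (by positivity) hSe 2
    nlinarith
  have h8 : r ^ 2 * (δ * r ^ 4) < e ^ 2 / 4 := by
    have h9 : (ε * r ^ 3) ^ 2 < e ^ 2 := pow_lt_pow_left₀ hlt hpos.le two_ne_zero
    have h10 : 4 * δ * r ^ 6 ≤ ε ^ 2 * r ^ 6 := mul_le_mul_of_nonneg_right hδ (by positivity)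
    nlinarith
  have h11 := h1.trans (mul_le_mul_of_nonneg_left h5 (sq_nonneg r))
  nlinarith

open Classical in
/-- Few edges meet the vertices of high degree or high path excess. -/
lemma exists_le_degree_pathExcess_le (G : SimpleGraph V) {r ε γ δ : ℝ} (hr : 0 < r)
    (hn : (Fintype.card V : ℝ) = r ^ 2) (hε : 0 < ε) (hγ : 0 < γ) (hδ : 4 * δ ≤ ε ^ 2)
    (hδ' : 2 * δ ≤ ε * γ) (hεr : 4 ≤ ε * r) (hL : ∑ x, G.pathExcess x ≤ δ * r ^ 4) :
    ∃ G' ≤ G, (∀ x, ∑ y, G'.adjMatrix ℝ x y ≤ 2 * r) ∧ (∀ x, G'.pathExcess x ≤ γ * r ^ 2) ∧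
      adjCount G (fun x y => ¬ G'.Adj x y) ≤ 4 * ε * r ^ 3 := by
  let S₁ : Finset V := {x | 2 * r < ∑ y, G.adjMatrix ℝ x y}
  let S₂ : Finset V := {x | ∑ y, G.adjMatrix ℝ x y ≤ 2 * r ∧ γ * r ^ 2 < G.pathExcess x}
  let S := S₁ ∪ S₂
  obtain ⟨G', hG'⟩ : ∃ G' : SimpleGraph V, ∀ x y, G'.Adj x y ↔ G.Adj x y ∧ x ∉ S ∧ y ∉ S :=
    ⟨{ Adj := fun x y => G.Adj x y ∧ x ∉ S ∧ y ∉ S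
       symm := ⟨fun x y h => ⟨h.1.symm, h.2.2, h.2.1⟩⟩
       loopless := ⟨fun x h => G.irrefl h.1⟩ }, fun _ _ => Iff.rfl⟩
  have hle : G' ≤ G := fun x y h => ((hG' x y).1 h).1
  have hzero : ∀ x ∈ S, ∀ y, G'.adjMatrix ℝ x y = 0 := fun x hx y => by
    rw [SimpleGraph.adjMatrix_apply, if_neg fun h => ((hG' x y).1 h).2.1 hx]
  refine ⟨G', hle, fun x => ?_, fun x => ?_, ?_⟩
  · by_cases hx : x ∈ S
    · rw [Finset.sum_eq_zero fun y _ => hzero x hx y]; positivity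
    · have : x ∉ S₁ := fun h => hx (mem_union_left _ h)
      simp only [S₁, mem_filter, mem_univ, true_and, not_lt] at this
      exact (Finset.sum_le_sum fun y _ => SimpleGraph.adjMatrix_mono hle x y).trans this
  · by_cases hx : x ∈ S
    · refine le_trans (le_of_eq ?_) (by positivity)
      refine Finset.sum_eq_zero fun y _ => ?_
      have : (G'.adjMatrix ℝ * G'.adjMatrix ℝ) x y = 0 := by
        rw [mul_apply]
        exact Finset.sum_eq_zero fun z _ => by rw [hzero x hx, zero_mul]
      change _ - min _ _ = _
      rw [this]
      simp
    · have h1 : x ∉ S₁ := fun h => hx (mem_union_left _ h)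
      have h2 : x ∉ S₂ := fun h => hx (mem_union_right _ h)
      simp only [S₁, S₂, mem_filter, mem_univ, true_and, not_lt, not_and] at h1 h2
      exact (SimpleGraph.pathExcess_mono hle x).trans (h2 h1)
  · have h1 : ∑ x ∈ S₁, ∑ y, G.adjMatrix ℝ x y ≤ ε * r ^ 3 :=
      sum_degree_high_le G hr hn hε hδ hεr hL fun x hx => (mem_filter.1 hx).2.le
    have h2 : ∑ x ∈ S₂, ∑ y, G.adjMatrix ℝ x y ≤ ε * r ^ 3 := by
      have hc : #S₂ * (γ * r ^ 2) ≤ δ * r ^ 4 := by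
        refine le_trans ?_ hL
        refine le_trans ?_ (Finset.sum_le_sum_of_subset_of_nonneg (subset_univ S₂)
          fun x _ _ => G.pathExcess_nonneg x)
        simpa using Finset.card_nsmul_le_sum S₂ _ _ fun x hx => (mem_filter.1 hx).2.2.le
      have hd : ∑ x ∈ S₂, ∑ y, G.adjMatrix ℝ x y ≤ #S₂ * (2 * r) := by
        simpa using Finset.sum_le_card_nsmul S₂ _ _ fun x hx => (mem_filter.1 hx).2.1
      have hc' : #S₂ * γ ≤ δ * r ^ 2 := by
        have : #S₂ * γ * r ^ 2 ≤ δ * r ^ 2 * r ^ 2 := by linarith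
        exact le_of_mul_le_mul_right this (by positivity)
      have h3 : γ * (#S₂ * (2 * r)) ≤ γ * (ε * r ^ 3) := by
        have h4 := mul_le_mul_of_nonneg_right hc' (by positivity : 0 ≤ 2 * r)
        have h5 := mul_le_mul_of_nonneg_right hδ' (by positivity : 0 ≤ r ^ 3)
        linarith
      exact hd.trans (le_of_mul_le_mul_left h3 hγ)
    have h3 : ∑ x ∈ S, ∑ y, G.adjMatrix ℝ x y ≤ 2 * (ε * r ^ 3) := by
      have := Finset.sum_union_inter (s₁ := S₁) (s₂ := S₂) (f := fun x => ∑ y, G.adjMatrix ℝ x y)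
      have h4 : 0 ≤ ∑ x ∈ S₁ ∩ S₂, ∑ y, G.adjMatrix ℝ x y := Finset.sum_nonneg fun x _ =>
        Finset.sum_nonneg fun y _ => SimpleGraph.adjMatrix_nonneg G x y
      linarith
    calc _ ≤ adjCount G (fun x y => x ∈ S ∨ y ∈ S) := adjCount_mono fun x y h h' => by
            by_contra! hcon
            exact h' ((hG' x y).2 ⟨h, hcon.1, hcon.2⟩)
      _ ≤ _ := adjCount_or_le G _ _
      _ = 2 * ∑ x ∈ S, ∑ y, G.adjMatrix ℝ x y := by
            rw [adjCount_swap G fun x _ => x ∈ S, adjCount_left]; ring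
      _ ≤ 4 * ε * r ^ 3 := by linarith

end

/-! ### Bad blocks, choice of constants and conclusion. -/

/-- A triangle that retraces one of its edges is a closed walk of length five, so one counting
argument excludes both cycles. -/
lemma exists_closedWalk_of_not_free {V : Type*} {G : SimpleGraph V}
    (h : ¬ ((SimpleGraph.cycleGraph 3).Free G ∧ (SimpleGraph.cycleGraph 5).Free G)) :
    ∃ p : Fin 5 → V, ∀ i, G.Adj (p i) (p (i + 1)) := by
  by_cases h3 : (SimpleGraph.cycleGraph 3).Free G
  · have h5 : ¬ (SimpleGraph.cycleGraph 5).Free G := fun h5 => h ⟨h3, h5⟩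
    obtain ⟨f⟩ := not_not.1 h5
    exact ⟨f, fun i => f.toHom.map_adj (SimpleGraph.cycleGraph_adj.2 (Or.inr (by simp)))⟩
  · obtain ⟨f⟩ := not_not.1 h3
    have hf : ∀ i j, i ≠ j → G.Adj (f i) (f j) := fun i j hij =>
      f.toHom.map_adj (by rw [SimpleGraph.cycleGraph_three_eq_top]; exact hij)
    refine ⟨![f 0, f 1, f 0, f 1, f 2], fun i => ?_⟩
    fin_cases i
    · exact hf 0 1 (by decide)
    · exact hf 1 0 (by decide)
    · exact hf 0 1 (by decide)
    · exact hf 1 2 (by decide)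
    · exact hf 2 0 (by decide)

section

variable {V : Type*} [Fintype V]

/-- Markov's inequality for 1/`fibreCard`, whose sum is the number of fibres. -/
lemma card_fibreCard_lt_le (q : V → ℕ) {t : ℝ} (ht : 0 ≤ t) :
    (#{x | (fibreCard q x : ℝ) < t} : ℝ) ≤ t * #(univ.image q) := by
  rw [← sum_inv_fibreCard, Finset.mul_sum]
  rw [← Finset.sum_boole]
  refine Finset.sum_le_sum fun x _ => ?_
  have hx : (0 : ℝ) < fibreCard q x := by exact_mod_cast fibreCard_pos q x
  split_ifs with h
  · rw [← div_eq_mul_inv, one_le_div hx]; exact h.le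
  · positivity

open Classical in
/-- Few edges lie in blocks that are small, sparse, or irregular. -/
lemma adjCount_bad_blocks_le (G : SimpleGraph V) {r α η τ θ : ℝ} (hr : 0 < r)
    (hn : (Fintype.card V : ℝ) = r ^ 2) (hα : 0 < α) (hη : 0 < η) (hθ : 0 < θ)
    (hdeg : ∀ x, ∑ y, G.adjMatrix ℝ x y ≤ 2 * r) {P Q : V → ℕ} (hr' : FibreRefines Q P)
    (hE : blockEnergy Q (G.adjMatrix ℝ) - blockEnergy P (G.adjMatrix ℝ) ≤ τ * r ^ 2) {m : ℕ}
    (hP : #(univ.image P) ≤ m) :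
    adjCount G (fun x y => ¬ (η * r ^ 2 ≤ fibreCard P x ∧ η * r ^ 2 ≤ fibreCard P y ∧
      blockAvg P (belowIndicator (blockAvg Q (G.adjMatrix ℝ)) (α / 2 / r)) x y ≤ θ))
      ≤ (4 * (m * η) + α + 4 * τ / (α * θ)) * r ^ 3 := by
  set A := G.adjMatrix ℝ with hA
  set f := blockAvg P A with hf
  set b := belowIndicator (blockAvg Q A) (α / 2 / r) with hb
  have hA0 : ∀ x y, 0 ≤ A x y := SimpleGraph.adjMatrix_nonneg G
  have hf0 : ∀ x y, 0 ≤ f x y := blockAvg_nonneg P hA0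
  have hfc : BlockConst P f := blockAvg_blockConst P A
  have small : adjCount G (fun x _ => (fibreCard P x : ℝ) < η * r ^ 2) ≤ 2 * (m * η) * r ^ 3 := by
    have h1 := adjCount_left G {x | (fibreCard P x : ℝ) < η * r ^ 2}
    simp only [mem_filter, mem_univ, true_and] at h1
    rw [h1]
    have h2 := Finset.sum_le_card_nsmul {x | (fibreCard P x : ℝ) < η * r ^ 2} _ _
      fun x _ => hdeg x
    rw [nsmul_eq_mul] at h2
    refine h2.trans ?_
    have h3 : η * r ^ 2 * #(univ.image P) ≤ η * r ^ 2 * m :=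
      mul_le_mul_of_nonneg_left (Nat.cast_le.2 hP) (by positivity)
    have h4 := mul_le_mul_of_nonneg_right ((card_fibreCard_lt_le P (by positivity)).trans h3)
      (by positivity : 0 ≤ 2 * r)
    exact h4.trans_eq (by ring)
  have sparse : adjCount G (fun x y => f x y < α / r) ≤ α * r ^ 3 := by
    have hφ : BlockConst P fun x y => if f x y < α / r then (1 : ℝ) else 0 :=
      fun x x' y y' hx hy => by simp only [hfc x x' y y' hx hy]
    rw [adjCount_eq_sum_mul, ← sum_sum_blockAvg_mul hφ]
    have h1 : ∀ x y, f x y * (if f x y < α / r then (1 : ℝ) else 0) ≤ α / r := fun x y => by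
      split_ifs with h
      · rw [mul_one]; exact h.le
      · rw [mul_zero]; positivity
    refine (Finset.sum_le_sum fun x _ => Finset.sum_le_sum fun y _ => h1 x y).trans_eq ?_
    simp only [Finset.sum_const, Finset.card_univ, nsmul_eq_mul, hn]
    field_simp
  have irregular : adjCount G (fun x y => α / r ≤ f x y ∧ θ < blockAvg P b x y)
      ≤ 4 * τ / (α * θ) * r ^ 3 := by
    let φ : Matrix V V ℝ := fun x y => if α / r ≤ f x y ∧ θ < blockAvg P b x y then 1 else 0
    have hφ : BlockConst P φ := fun x x' y y' hx hy => by
      simp only [φ, hfc x x' y y' hx hy, blockAvg_blockConst P b x x' y y' hx hy]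
    have hφf : BlockConst P fun x y => f x y ^ 2 * φ x y := fun x x' y y' hx hy => by
      simp only [hφ x x' y y' hx hy, hfc x x' y y' hx hy]
    have h1 : θ * ∑ x, ∑ y, f x y ^ 2 * φ x y ≤ ∑ x, ∑ y, b x y * (f x y ^ 2 * φ x y) := by
      rw [← sum_sum_blockAvg_mul hφf, Finset.mul_sum]
      refine Finset.sum_le_sum fun x _ => ?_
      rw [Finset.mul_sum]
      refine Finset.sum_le_sum fun y _ => ?_
      by_cases h : α / r ≤ f x y ∧ θ < blockAvg P b x y
      · exact mul_le_mul_of_nonneg_right h.2.le (by simp only [φ, if_pos h]; positivity)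
      · simp [φ, h]
    -- Where the coarse density f is at least α/r and the fine one is below α/(2r), they differ by
    -- at least f/2. The energy gap therefore controls the sum of f² there, and f ≤ (r/α)f² turns
    -- this into an edge count.
    have h2 : ∑ x, ∑ y, b x y * (f x y ^ 2 * φ x y)
        ≤ ∑ x, ∑ y, 4 * (blockAvg Q A x y - f x y) ^ 2 := by
      refine Finset.sum_le_sum fun x _ => Finset.sum_le_sum fun y _ => ?_
      by_cases h : α / r ≤ f x y ∧ θ < blockAvg P b x y
      · simp only [φ, hb, belowIndicator]
        split_ifs with h'
        · have h3 : α / 2 / r = α / r / 2 := by ring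
          rw [h3] at h'
          nlinarith [h.1, hf0 x y]
        · nlinarith [sq_nonneg (blockAvg Q A x y - f x y)]
      · simp only [φ, if_neg h, mul_zero]
        positivity
    simp only [← Finset.mul_sum] at h2
    rw [sum_sq_sub_blockAvg hr'] at h2
    have h4 : ∑ x, ∑ y, f x y * φ x y ≤ r / α * ∑ x, ∑ y, f x y ^ 2 * φ x y := by
      simp only [Finset.mul_sum]
      refine Finset.sum_le_sum fun x _ => Finset.sum_le_sum fun y _ => ?_
      by_cases h : α / r ≤ f x y ∧ θ < blockAvg P b x y
      · simp only [φ, if_pos h, mul_one]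
        have h5 : 1 ≤ r / α * f x y := by
          have := mul_le_mul_of_nonneg_left h.1 (by positivity : 0 ≤ r / α)
          refine le_trans (le_of_eq ?_) this
          field_simp
        nlinarith [hf0 x y]
      · simp [φ, h]
    have h6 : adjCount G (fun x y => α / r ≤ f x y ∧ θ < blockAvg P b x y)
        = ∑ x, ∑ y, f x y * φ x y := by
      refine (adjCount_eq_sum_mul _ _).trans (Eq.trans ?_ (sum_sum_blockAvg_mul (G := A) hφ).symm)
      refine Finset.sum_congr rfl fun x _ => Finset.sum_congr rfl fun y _ => ?_
      simp only [φ, hA]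
      congr
    rw [h6]
    have h7 : ∑ x, ∑ y, f x y ^ 2 * φ x y ≤ 4 * (τ * r ^ 2) / θ := by
      rw [le_div_iff₀ hθ]
      linarith
    refine (h4.trans (mul_le_mul_of_nonneg_left h7 (by positivity))).trans_eq ?_
    field_simp
  have hcover := adjCount_mono (G := G)
    (R := fun x y => ¬ (η * r ^ 2 ≤ fibreCard P x ∧ η * r ^ 2 ≤ fibreCard P y ∧
      blockAvg P b x y ≤ θ))
    (S := fun x y => (((fibreCard P x : ℝ) < η * r ^ 2 ∨ (fibreCard P y : ℝ) < η * r ^ 2) ∨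
      f x y < α / r) ∨ (α / r ≤ f x y ∧ θ < blockAvg P b x y))
    fun x y _ h => by
      by_contra! hcon
      exact h ⟨hcon.1.1.1, hcon.1.1.2, hcon.2 hcon.1.2⟩
  have o1 := adjCount_or_le G (fun x y => ((fibreCard P x : ℝ) < η * r ^ 2 ∨
    (fibreCard P y : ℝ) < η * r ^ 2) ∨ f x y < α / r)
    (fun x y => α / r ≤ f x y ∧ θ < blockAvg P b x y)
  have o2 := adjCount_or_le G (fun x y => (fibreCard P x : ℝ) < η * r ^ 2 ∨
    (fibreCard P y : ℝ) < η * r ^ 2) (fun x y => f x y < α / r)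
  have o3 := adjCount_or_le G (fun x _ => (fibreCard P x : ℝ) < η * r ^ 2)
    (fun _ y => (fibreCard P y : ℝ) < η * r ^ 2)
  rw [adjCount_swap G fun x _ => (fibreCard P x : ℝ) < η * r ^ 2] at o3
  linarith

open Classical in
lemma sum_mul_self_sub_trunc_le {G : SimpleGraph V} {D t : ℝ} {x : V}
    (hdeg : ∑ y, G.adjMatrix ℝ x y ≤ D) (hexc : G.pathExcess x ≤ t) :
    ∑ y, ((G.adjMatrix ℝ * G.adjMatrix ℝ) x y - (G.adjMatrix ℝ * G.adjMatrix ℝ).trunc x y)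
      ≤ D + t := by
  rw [← Finset.add_sum_erase _ _ (mem_univ x)]
  refine add_le_add ?_ hexc
  have h0 := SimpleGraph.adjMatrix_nonneg G
  have := (trunc_mem (mul_apply_nonneg h0 h0) x x).1
  rw [G.adjMatrix_mul_self_diag] at *
  linarith

end

open Classical in
/-- A graph with bounded degrees and few excess paths of length two, and few pentagons inside a
larger graph `G'`, has a subgraph without triangles and pentagons missing only few edges. -/
lemma exists_subgraph_free {ε : ℝ} (hε : 0 < ε) :
    ∃ γ c R : ℝ, 0 < γ ∧ 0 < c ∧ ∀ (V : Type*) [Fintype V] (G G' : SimpleGraph V) (r : ℝ),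
      G ≤ G' → R ≤ r → 0 < r → (Fintype.card V : ℝ) = r ^ 2 →
      (∀ x, ∑ y, G.adjMatrix ℝ x y ≤ 2 * r) → (∀ x, G.pathExcess x ≤ γ * r ^ 2) →
      (G'.copyCount (SimpleGraph.cycleGraph 5) : ℝ) ≤ c * r ^ 5 →
      ∃ H ≤ G, (SimpleGraph.cycleGraph 3).Free H ∧ (SimpleGraph.cycleGraph 5).Free H ∧
        adjCount G (fun x y => ¬ H.Adj x y) ≤ ε * r ^ 3 := by
  -- Sparse, irregular and small blocks get ε/6 each, through α, τ and η. The total ε/2 is doubled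
  -- when goodness is asked in both orders.
  set α := min (ε / 6) 1 with hα
  have hα0 : 0 < α := by positivity
  have hα1 : α ≤ 1 := min_le_right _ _
  have hαε : α ≤ ε / 6 := min_le_left _ _
  set θ : ℝ := 1 / 1000 with hθ
  set τ := α * θ * ε / 24 with hτ
  have hτ0 : 0 < τ := by positivity
  let η : ℕ → ℝ := fun m => ε / (24 * (m + 1))
  have hη0 : ∀ m, 0 < η m := fun m => by positivity
  have hηm : ∀ m, m * η m ≤ ε / 24 := fun m => by
    have : (m : ℝ) * η m = ε / 24 * (m / (m + 1)) := by simp only [η]; field_simp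
    rw [this]
    refine mul_le_of_le_one_right (by positivity) ?_
    rw [div_le_one (by positivity)]
    linarith
  have hη_anti : ∀ {k m : ℕ}, k ≤ m → η m ≤ η k := fun {k m} h => by
    have : (k : ℝ) ≤ m := Nat.cast_le.2 h
    simp only [η]
    gcongr
  -- The main term of the pentagon count, in units of r⁵. The errors 10κ and 20γ each take at most a
  -- quarter of it, so more than c M / 4 is left.
  let c : ℕ → ℝ := fun m => (α / 2) ^ 5 * (η m / 10) ^ 5 / 2
  have hc0 : ∀ m, 0 < c m := fun m => by have := hη0 m; positivity
  have hc_anti : ∀ {k m : ℕ}, k ≤ m → c m ≤ c k := fun {k m} h => by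
    have := hη_anti h
    have := (hη0 m).le
    simp only [c]
    gcongr
  let κ : ℕ → ℝ := fun m => c m / 40
  have hκ0 : ∀ m, 0 < κ m := fun m => by have := hc0 m; positivity
  set M := regularityBound κ (⌊2 / τ⌋₊ + 1) with hM
  have hM0 : (0 : ℝ) < M := by exact_mod_cast regularityBound_pos κ _
  -- The second bound keeps the energy at most 2|V| for every partition into at most M parts.
  set γ := min (c M / 80) (1 / (2 * M)) with hγ
  have hγ0 : 0 < γ := lt_min (by have := hc0 M; positivity) (by positivity)
  have hγc : γ ≤ c M / 80 := min_le_left _ _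
  have hγM : M * (2 * γ) ≤ 1 := by
    have : γ ≤ 1 / (2 * M) := min_le_right _ _
    rw [le_div_iff₀ (by positivity)] at this
    linarith
  -- r ≥ 2/γ lets γr² absorb the diagonal entry of A², a degree of at most 2r; r ≥ 5/η M, with r ≥
  -- 1, gives large fibres at least 5 vertices.
  refine ⟨γ, c M / 4, 2 / γ + 5 / η M + 1, hγ0, by have := hc0 M; positivity, ?_⟩
  intro V _ G G' r hGG' hR hr hn hdeg hexc hcount
  have hηM := hη0 M
  have hγr : 2 * r ≤ γ * r ^ 2 := by
    have h1 : 2 / γ ≤ r := by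
      have : 0 ≤ 5 / η M := by positivity
      linarith
    rw [div_le_iff₀ hγ0] at h1
    nlinarith
  have hηr : 5 ≤ η M * r ^ 2 := by
    have h0 : 0 ≤ 2 / γ := by positivity
    have h0' : 0 ≤ 5 / η M := by positivity
    have h1 : 5 / η M ≤ r := by linarith
    have h2 : 1 ≤ r := by linarith
    rw [div_le_iff₀ hηM] at h1
    nlinarith [mul_nonneg hηM.le hr.le]
  have hsum : ∀ x, ∑ y, ((G.adjMatrix ℝ * G.adjMatrix ℝ) x y
      - (G.adjMatrix ℝ * G.adjMatrix ℝ).trunc x y) ≤ 2 * γ * r ^ 2 := fun x =>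
    (sum_mul_self_sub_trunc_le (hdeg x) (hexc x)).trans (by linarith)
  have hsymm : (G.adjMatrix ℝ)ᵀ = G.adjMatrix ℝ := SimpleGraph.transpose_adjMatrix ..
  obtain ⟨P, Q, i, hi, hP, hPQ, hE, hcut⟩ := exists_strong_regular hκ0 hτ0
    (G := G.adjMatrix ℝ) fun q hq => by
      have h1 := blockEnergy_le q hsymm hsum
      have h2 : (#(univ.image q) : ℝ) * (2 * γ * r ^ 2) ≤ M * (2 * γ) * r ^ 2 := by
        have : (#(univ.image q) : ℝ) ≤ M := Nat.cast_le.2 hq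
        have h3 : 0 ≤ 2 * γ * r ^ 2 := by positivity
        exact (mul_le_mul_of_nonneg_right this h3).trans_eq (by ring)
      have h3 := mul_le_mul_of_nonneg_right hγM (sq_nonneg r)
      rw [hn] at h1 ⊢
      linarith
  set m := regularityBound κ i with hm
  have hmM : m ≤ M := regularityBound_mono κ (hi.trans (Nat.le_succ _))
  have hsq : √(Fintype.card V : ℝ) = r := by rw [hn, Real.sqrt_sq hr.le]
  rw [hsq] at hcut
  rw [hn] at hE
  set A := G.adjMatrix ℝ with hA
  let good : V → V → Prop := fun x y =>
    η m * r ^ 2 ≤ fibreCard P x ∧ η m * r ^ 2 ≤ fibreCard P y ∧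
      blockAvg P (belowIndicator (blockAvg Q A) (α / 2 / r)) x y ≤ θ
  have hbad : adjCount G (fun x y => ¬ good x y) ≤ ε / 2 * r ^ 3 := by
    refine (adjCount_bad_blocks_le G hr hn hα0 (hη0 m) (by positivity) hdeg hPQ hE hP).trans ?_
    refine mul_le_mul_of_nonneg_right ?_ (by positivity)
    have h1 : 4 * τ / (α * θ) = ε / 6 := by rw [hτ]; field_simp; norm_num
    have h2 := hηm m
    rw [h1]
    linarith
  obtain ⟨H, hH⟩ : ∃ H : SimpleGraph V, ∀ x y, H.Adj x y ↔ G.Adj x y ∧ good x y ∧ good y x :=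
    ⟨{ Adj := fun x y => G.Adj x y ∧ good x y ∧ good y x
       symm := ⟨fun x y h => ⟨h.1.symm, h.2.2, h.2.1⟩⟩
       loopless := ⟨fun x h => G.irrefl h.1⟩ }, fun _ _ => Iff.rfl⟩
  have hfree : (SimpleGraph.cycleGraph 3).Free H ∧ (SimpleGraph.cycleGraph 5).Free H := by
    by_contra hcon
    obtain ⟨p, hp⟩ := exists_closedWalk_of_not_free hcon
    have hg : ∀ i, good (p i) (p (i + 1)) := fun i => ((hH _ _).1 (hp i)).2.1
    have h1 := le_copyCount_cycleGraph_five hGG' (a := α / 2) (η := η m) hr hn hγ0.le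
      (hκ0 m).le (by positivity) (by linarith) (hη0 m)
      (hηr.trans (mul_le_mul_of_nonneg_right (hη_anti hmM) (sq_nonneg r))) hdeg hsum hcut
      (fun i => (hg i).1) (fun i => (hg i).2.2)
    have h2 : (α / 2) ^ 5 * (η m / 10) ^ 5 / 2 - 10 * κ m - 20 * γ ≤ c M / 4 :=
      le_of_mul_le_mul_right (h1.trans hcount) (by positivity)
    have h3 : (α / 2) ^ 5 * (η m / 10) ^ 5 / 2 = c m := rfl
    have h4 : κ m = c m / 40 := rfl
    have h5 := hc_anti hmM
    have h6 := hc0 M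
    rw [h3, h4] at h2
    linarith
  refine ⟨H, fun x y h => ((hH x y).1 h).1, hfree.1, hfree.2, ?_⟩
  calc _ ≤ adjCount G (fun x y => ¬ good x y ∨ ¬ good y x) := adjCount_mono fun x y h h' => by
          by_contra! hcon
          exact h' ((hH x y).2 ⟨h, hcon⟩)
    _ ≤ _ := adjCount_or_le G _ _
    _ = 2 * adjCount G (fun x y => ¬ good x y) := by
          rw [adjCount_swap G fun x y => ¬ good x y]; ring
    _ ≤ ε * r ^ 3 := by linarith

theorem theorem1p2 (ε : ℝ) (hε : 0 < ε) :
    ∃ (δ : ℝ) (n₀ : ℕ), 0 < δ ∧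
      ∀ (n : ℕ), n₀ ≤ n → ∀ (V : Type*) [Fintype V], Fintype.card V = n →
        ∀ G : SimpleGraph V,
          (G.copyCount (SimpleGraph.cycleGraph 4) : ℝ) ≤ δ * (n : ℝ) ^ 2 →
          (G.copyCount (SimpleGraph.cycleGraph 5) : ℝ) ≤ δ * (n : ℝ) ^ (5 / 2 : ℝ) →
          ∃ E : Finset (Sym2 V), (E : Set (Sym2 V)) ⊆ G.edgeSet ∧
            (E.card : ℝ) ≤ ε * (n : ℝ) ^ (3 / 2 : ℝ) ∧
            (SimpleGraph.cycleGraph 3).Free (G.deleteEdges (E : Set (Sym2 V))) ∧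
            (SimpleGraph.cycleGraph 5).Free (G.deleteEdges (E : Set (Sym2 V))) := by
  classical
  obtain ⟨γ, c, R, hγ, hc, key⟩ := exists_subgraph_free (half_pos hε)
  set ε' := ε / 8 with hε'
  have hε'0 : 0 < ε' := by positivity
  -- The cleaning step is applied with 256δ, the bound on the path excess, so its constants 4 and 2
  -- become 1024 and 512. Its cost 4ε' is ε/2.
  set δ := min (ε' ^ 2 / 1024) (min (ε' * γ / 512) c) with hδ
  have hδ0 : 0 < δ := by positivity
  have hδ1 : 1024 * δ ≤ ε' ^ 2 := by linarith [min_le_left (ε' ^ 2 / 1024) (min (ε' * γ / 512) c)]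
  have hδ' := min_le_right (ε' ^ 2 / 1024) (min (ε' * γ / 512) c)
  have hδ2 : 512 * δ ≤ ε' * γ := by linarith [min_le_left (ε' * γ / 512) c]
  have hδ3 : δ ≤ c := hδ'.trans (min_le_right _ _)
  set R' := max R (max (4 / ε') 1) with hR'
  have hR'0 : 0 < R' := one_pos.trans_le ((le_max_right _ _).trans (le_max_right _ _))
  refine ⟨δ, ⌈R' ^ 2⌉₊, hδ0, fun n hn V _ hV G h4 h5 => ?_⟩
  set r := √(n : ℝ) with hr
  have hRr : R' ≤ r := Real.le_sqrt_of_sq_le ((Nat.le_ceil _).trans (Nat.cast_le.2 hn))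
  have hr0 : 0 < r := hR'0.trans_le hRr
  have hnr : (n : ℝ) = r ^ 2 := (Real.sq_sqrt (Nat.cast_nonneg n)).symm
  have hpow : ∀ k : ℕ, (n : ℝ) ^ ((k : ℝ) / 2) = r ^ k := fun k => by
    rw [hr, Real.sqrt_eq_rpow, ← Real.rpow_natCast, ← Real.rpow_mul (Nat.cast_nonneg n)]
    congr 1
    ring
  have hp3 : (n : ℝ) ^ (3 / 2 : ℝ) = r ^ 3 := by exact_mod_cast hpow 3
  have hp5 : (n : ℝ) ^ (5 / 2 : ℝ) = r ^ 5 := by exact_mod_cast hpow 5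
  rw [hp5] at h5
  rw [hp3]
  have hVr : (Fintype.card V : ℝ) = r ^ 2 := by rw [hV, hnr]
  have hL : ∑ x, G.pathExcess x ≤ 256 * δ * r ^ 4 := by
    refine G.sum_pathExcess_le.trans ?_
    rw [hnr] at h4
    linarith
  have hεr : 4 ≤ ε' * r := by
    have h1 : 4 / ε' ≤ r := ((le_max_left _ _).trans (le_max_right _ _)).trans hRr
    rw [div_le_iff₀ hε'0] at h1
    linarith
  obtain ⟨G₁, hG₁, hdeg, hexc, hcount⟩ := exists_le_degree_pathExcess_le G hr0 hVr hε'0 hγ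
    (by linarith) (by linarith) hεr hL
  obtain ⟨H, hH, hH3, hH5, hHcount⟩ := key V G₁ G r hG₁ ((le_max_left _ _).trans hRr) hr0 hVr
    (fun x => by convert hdeg x) hexc
    (h5.trans (mul_le_mul_of_nonneg_right hδ3 (by positivity)))
  obtain ⟨E, hE, hEcard, hdel⟩ := exists_finset_deleteEdges (hH.trans hG₁)
  refine ⟨E, hE, hEcard.trans ?_, hdel ▸ hH3, hdel ▸ hH5⟩
  have h1 : adjCount G (fun x y => ¬ H.Adj x y)
      ≤ adjCount G (fun x y => ¬ G₁.Adj x y) + adjCount G₁ (fun x y => ¬ H.Adj x y) := by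
    have h2 : adjCount G₁ (fun x y => ¬ H.Adj x y)
        = adjCount G (fun x y => G₁.Adj x y ∧ ¬ H.Adj x y) := by
      refine Finset.sum_congr rfl fun x _ => Finset.sum_congr rfl fun y _ => ?_
      by_cases h : G₁.Adj x y
      · simp [h, hG₁ h]
      · simp [h]
    rw [h2]
    refine (adjCount_mono fun x y _ h => ?_).trans (adjCount_or_le G _ _)
    by_cases h3 : G₁.Adj x y
    · exact Or.inr ⟨h3, h⟩
    · exact Or.inl h3
  have h2 : 4 * ε' * r ^ 3 + ε / 2 * r ^ 3 = ε * r ^ 3 := by rw [hε']; ring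
  linarith
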